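/- Let $a,b\in\mathbb C\setminus\{0\}$, $E(z)=ae^z+be^{-z}$, $F(t)=e^t-1$, and let $E^{\circ k}$, $F^{\circ k}$ denote iterates. A point $z$ is *escaping* if $|E^{\circ k}(z)|\to\infty$. *Partition.* Let $c=\frac12\ln(b/a)$ with $|\operatorname{Im}c|\le\pi/2$, $v_1=E(c)$, $v_2=E(c+i\pi)$ (the critical values). Let $\mathcal A$ be the segment $[v_1,v_2]$ together with the vertical ray starting at $v_1$, directed upwards if $\operatorname{Im}v_1\ge\operatorname{Im}v_2$ and downwards otherwise. The *strips* $R_{(n,L)},R_{(n,R)}$ $(n\in\mathbb Z)$ are the connected components of $E^{-1}(\mathbb C\setminus\mathcal A)$, labelled so that $\overline{R_{(0,R)}}$ contains a right end of $\mathbb R$, $\overline{R_{(0,L)}}$ contains a left end of $\mathbb R$, and $R_{(n+1,\ast)}=R_{(n,\ast)}+2\pi i$. *Addresses.* An *external address* is a sequence $s=s_1s_2s_3\ldots$ in $\mathbb Z\times\{L,R\}$; $|(n,\ast)|:=|n|$, and $\sigma$ is the shift. A point $z$ has external address $s$ if $E^{\circ(k-1)}(z)\in R_{s_k}\setminus\mathcal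 A$ for all $k\ge1$. The address $s$ is *exponentially bounded* if for some $x>0$, $|s_k|\le F^{\circ(k-1)}(x)$ for all $k\ge1$; its *minimal potential* is $t_s=\inf\{t>0:\lim_k |s_k|/F^{\circ(k-1)}(t)=0\}$. It is *slow* if there are $A,x>0$ and infinitely many $n$ such that $|s_{n+k}|\le A\,F^{\circ(k-1)}(x)$ for all $k\ge1$, and *fast* otherwise. *Rays.* A *ray tail* with address $s$ is an injective curve $g:[\tau,\infty)\to\mathbb C$ $(\tau>0)$ of escaping points with external address $s$ such that $\operatorname{Re}g(t)\to+\infty$ or $\operatorname{Re}g(t)\to-\infty$ as $t\to\infty$ and, for every $t\ge\tau$, $E^{\circ k}(g(t))=\pm F^{\circ k}(t)+2\pi i n_{k+1}+O(1)$ as $k\to\infty$, where $n_{k+1}$ is the integer part of $s_{k+1}$ and the sign is $+$ if $s_{k+1}\in\mathbb Z\times\{R\}$ and $-$ if $s_{k+1}\in\mathbb Z\times\{L\}$. For exponentially bounded $s$, the *dynamic ray* at $s$ is the injective curve $g_s:(t_s,\infty)\to\mathbb C$ of escaping points which extends a ray tail with address $s$ and is obtained by pulling back ray tails along the orbit: there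 are such curves $g_{\sigma^n(s)}:(t_{\sigma^n(s)},\infty)\to\mathbb C$, each extending a ray tail with address $\sigma^n(s)$, with $E(g_{\sigma^n(s)}(t))=g_{\sigma^{n+1}(s)}(F(t))$ for all $n\ge0$ and $t>t_{\sigma^n(s)}$, and for every $t>t_s$ the restriction of $g_{\sigma^n(s)}$ to $[F^{\circ n}(t),\infty)$ is a ray tail with address $\sigma^n(s)$ for all large $n$. The ray $g_s$ is defined on all of $(t_s,\infty)$ only if no $g_{\sigma^n(s)}$ with $n\ge1$ contains $v_1$ or $v_2$; this is part of the definition (it is automatic if neither critical value escapes). The ray $g_s$ *lands* at $w\in\mathbb C$ if $\lim_{t\searrow t_s}g_s(t)=w$. If $w$ is escaping, the ray and its landing point *escape uniformly* if for every $\rho\in\mathbb R$ there is $N\ge0$ such that $|\operatorname{Re}E^{\circ n}(z)|>\rho$ for all $n\ge N$ and all $z\in g_s((t_s,\infty))\cup\{w\}$. **Proposition (Uniform Escape for Fast Addresses).** Let $s$ be an exponentially bounded external address for which the dynamic ray $g_s:(t_s,\infty)\to\mathbb C$ is defined. Then $s$ is fast if and only if $g_s$ lands at an escaping point such that the ray and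 its landing point escape uniformly. -/

import Mathlib

open Set Filter Topology

namespace CosineRays

noncomputable section

/-- The cosine map `E_{a,b}(z) = a e^z + b e^{-z}`. -/
def cosMap (a b z : ℂ) : ℂ := a * Complex.exp z + b * Complex.exp (-z)

/-- The model growth function `F(t) = e^t - 1`. -/
def F (t : ℝ) : ℝ := Real.exp t - 1

/-- A point escapes if its orbit under `E_{a,b}` tends to infinity in absolute value. -/
def IsEscaping (a b z : ℂ) : Prop :=
  Tendsto (fun k : ℕ => ‖(cosMap a b)^[k] z‖) atTop atTop

/-! ### The partition.
Throughout, `c` is a logarithm `(1/2) log (b/a)`, so the critical points are `c + π i n`. -/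

/-- The critical value `v₁`, the image of `c + 2 π i ℤ`. -/
def critVal₁ (a b c : ℂ) : ℂ := cosMap a b c

/-- The critical value `v₂`, the image of `c + i π + 2 π i ℤ`. -/
def critVal₂ (a b c : ℂ) : ℂ := cosMap a b (c + Real.pi * Complex.I)

/-- The set `𝒜`: the segment between the two critical values, together with the vertical ray that
starts at `v₁` and goes upwards if `Im v₁ ≥ Im v₂`, downwards if `Im v₁ < Im v₂`. -/
def slit (a b c : ℂ) : Set ℂ :=
  segment ℝ (critVal₁ a b c) (critVal₂ a b c) ∪
    {z | z.re = (critVal₁ a b c).re ∧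
      (((critVal₂ a b c).im ≤ (critVal₁ a b c).im ∧ (critVal₁ a b c).im ≤ z.im) ∨
        ((critVal₁ a b c).im < (critVal₂ a b c).im ∧ z.im ≤ (critVal₁ a b c).im))}

/-- The two kinds of strips. -/
inductive Side where
  | left : Side
  | right : Side

/-- The sign `-1` for left strips and `+1` for right strips. -/
def Side.sign : Side → ℝ
  | Side.left => -1
  | Side.right => 1

/-- The strips `R_{(n,L)}`, `R_{(n,R)}`: the connected components of `E⁻¹(ℂ \ 𝒜)`, labelled so that
the closure of `R_{(0,R)}` contains a right end of the real line, the closure of `R_{(0,L)}`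
contains a left end of it, and the translation by `2 π i` raises the label by one. (The labelling
is unique unless an end of the real line is the common boundary of two strips.) -/
structure IsStripLabelling (a b c : ℂ) (strip : ℤ × Side → Set ℂ) : Prop where
  component : ∀ j, ∃ z ∈ cosMap a b ⁻¹' (slit a b c)ᶜ,
    strip j = connectedComponentIn (cosMap a b ⁻¹' (slit a b c)ᶜ) z
  right_end : ∃ x : ℝ, ∀ y : ℝ, x ≤ y → (y : ℂ) ∈ closure (strip (0, Side.right))
  left_end : ∃ x : ℝ, ∀ y : ℝ, y ≤ x → (y : ℂ) ∈ closure (strip (0, Side.left))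
  translate : ∀ (n : ℤ) (d : Side) (z : ℂ),
    z ∈ strip (n, d) ↔ z + 2 * Real.pi * Complex.I ∈ strip (n + 1, d)

/-! ### External addresses.
An address `s₁ s₂ s₃ …` is a function on `ℕ` whose value at `k` is the entry `s_{k+1}`. -/

/-- The space of external addresses. -/
abbrev Address : Type := ℕ → ℤ × Side

/-- The shift `σ`. -/
def shift (s : Address) : Address := fun k => s (k + 1)

/-- The absolute value `|n|` of the entries `(n, L)` and `(n, R)`. -/
def entryAbs (j : ℤ × Side) : ℝ := |(j.1 : ℝ)|

/-- The orbit of `z` avoids `𝒜` and `s` is the sequence of the labels of the strips visited. -/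
def HasAddress (a b c : ℂ) (strip : ℤ × Side → Set ℂ) (s : Address) (z : ℂ) : Prop :=
  (∀ k : ℕ, (cosMap a b)^[k] z ∉ slit a b c) ∧ ∀ k : ℕ, (cosMap a b)^[k] z ∈ strip (s k)

/-- `s` is exponentially bounded: `|s_k| ≤ F^{∘(k-1)}(x)` for some `x > 0` and all `k ≥ 1`. -/
def ExponentiallyBounded (s : Address) : Prop :=
  ∃ x : ℝ, 0 < x ∧ ∀ k : ℕ, entryAbs (s k) ≤ F^[k] x

/-- The minimal potential `t_s = inf {t > 0 : |s_k| / F^{∘(k-1)}(t) → 0}`. It is used only for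
exponentially bounded `s`, where the infimum is over a nonempty set of positive reals. -/
def minPotential (s : Address) : ℝ :=
  sInf {t : ℝ | 0 < t ∧ Tendsto (fun k : ℕ => entryAbs (s k) / F^[k] t) atTop (𝓝 0)}

/-- `s` is slow: there are `A, x > 0` and infinitely many `n` with
`|s_{n+k}| ≤ A F^{∘(k-1)}(x)` for all `k ≥ 1`. -/
def IsSlow (s : Address) : Prop :=
  ∃ A x : ℝ, 0 < A ∧ 0 < x ∧ ∃ᶠ n : ℕ in atTop, ∀ k : ℕ, entryAbs (s (n + k)) ≤ A * F^[k] x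

/-- `s` is fast if it is not slow. -/
def IsFast (s : Address) : Prop := ¬ IsSlow s

/-! ### Ray tails and dynamic rays -/

/-- `g : [τ, ∞) → ℂ` is a ray tail with external address `s`: an injective curve of points
which escape within `ℂ \ 𝒜`, have external address `s`, and satisfy
`E^{∘k}(g(t)) = ± F^{∘k}(t) + 2 π i s_{k+1} + O(1)` as `k → ∞` (with the sign `+` for right and `-`
for left entries), and whose real part tends to `+∞` or to `-∞` as `t → ∞`. -/
structure IsRayTail (a b c : ℂ) (strip : ℤ × Side → Set ℂ) (s : Address) (τ : ℝ) (g : ℝ → ℂ) :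
    Prop where
  pos : 0 < τ
  continuousOn : ContinuousOn g (Ici τ)
  injOn : InjOn g (Ici τ)
  escaping : ∀ t, τ ≤ t → IsEscaping a b (g t)
  address : ∀ t, τ ≤ t → HasAddress a b c strip s (g t)
  re_tendsto : Tendsto (fun t => (g t).re) atTop atTop ∨ Tendsto (fun t => (g t).re) atTop atBot
  asymptotics : ∀ t, τ ≤ t → ∃ C : ℝ, ∀ k : ℕ,
    ‖(cosMap a b)^[k] (g t) -
      (((s k).2.sign * F^[k] t : ℝ) + 2 * Real.pi * Complex.I * ((s k).1 : ℂ))‖ ≤ C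

/-- `G n` is the dynamic ray at the external address `σⁿ(s)`, for every `n`. Each `G n` is an
injective curve of escaping points, defined on the potentials greater than the minimal potential of
`σⁿ(s)`, with `E(G n (t)) = G (n+1) (F(t))`, and extends a ray tail with address `σⁿ(s)`. The rays
are obtained by pulling back ray tails: for every `t > t_s` the part of `G n` at potentials
`≥ F^{∘n}(t)` is a ray tail as soon as `n` is large. No critical value lies on any of
`G 1, G 2, …`, that is, on the curves that are pulled back (otherwise the pull-back stops at a
potential greater than `t_s`, and there is no ray on all of `(t_s, ∞)`). -/
structure IsRayOrbit (a b c : ℂ) (strip : ℤ × Side → Set ℂ) (s : Address) (G : ℕ → ℝ → ℂ) :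
    Prop where
  continuousOn : ∀ n, ContinuousOn (G n) (Ioi (minPotential (shift^[n] s)))
  injOn : ∀ n, InjOn (G n) (Ioi (minPotential (shift^[n] s)))
  escaping : ∀ n t, minPotential (shift^[n] s) < t → IsEscaping a b (G n t)
  map_eq : ∀ n t, minPotential (shift^[n] s) < t → cosMap a b (G n t) = G (n + 1) (F t)
  extends_tail : ∀ n, ∃ τ, minPotential (shift^[n] s) < τ ∧
    IsRayTail a b c strip (shift^[n] s) τ (G n)
  eventually_tail : ∀ t, minPotential s < t →
    ∀ᶠ n : ℕ in atTop, IsRayTail a b c strip (shift^[n] s) (F^[n] t) (G n)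
  not_critVal : ∀ n, 1 ≤ n → ∀ t, minPotential (shift^[n] s) < t →
    G n t ≠ critVal₁ a b c ∧ G n t ≠ critVal₂ a b c

/-- `g : (t_s, ∞) → ℂ` is the dynamic ray at the external address `s`. -/
def IsDynamicRay (a b c : ℂ) (strip : ℤ × Side → Set ℂ) (s : Address) (g : ℝ → ℂ) : Prop :=
  ∃ G : ℕ → ℝ → ℂ, IsRayOrbit a b c strip s G ∧ G 0 = g

/-- The ray `g` at address `s` lands at `w`: `g(t) → w` as `t` decreases to `t_s`. -/
def LandsAt (s : Address) (g : ℝ → ℂ) (w : ℂ) : Prop :=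
  Tendsto g (𝓝[>] (minPotential s)) (𝓝 w)

/-- The ray `g` at address `s` and its landing point `w` escape uniformly: for every `ρ` there is an
`N` such that `|Re E^{∘n}| > ρ` on all of `g((t_s, ∞)) ∪ {w}` for every `n ≥ N`. -/
def EscapeUniformly (a b : ℂ) (s : Address) (g : ℝ → ℂ) (w : ℂ) : Prop :=
  ∀ ρ : ℝ, ∃ N : ℕ, ∀ n, N ≤ n →
    ρ < |((cosMap a b)^[n] w).re| ∧
      ∀ t, minPotential s < t → ρ < |((cosMap a b)^[n] (g t)).re|

end

end CosineRays

namespace CosineRays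

/-! The link between addresses and real parts is that the strip with integer part n lies within
bounded distance of height 2πn. Write E(z) = ae^z + be^{-z}; then |E(z)| is comparable to e^{|Re z|}
when |Re z| is large, with the upper bound valid everywhere.

Fast implies uniform escape. If |Re z| ≤ ρ for a point following the n-th shift of s, its orbit is
bounded by iterates of F at a point x depending only on ρ. Hence the entries after n are at most a
constant times these iterates. For a fast address this happens for finitely many n only, so late
iterates have large real parts, with a threshold independent of the point
(`IsFast.exists_lt_abs_re`). A backward induction over the iterates supplies the strip membership
this needs on the whole ray.

Uniform escape implies landing. Far from the imaginary axis E doubles distances within a strip when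
the images also share a strip (`IsStripLabelling.exists_expansion`). Real parts at lower potentials
cannot exceed those at higher ones by more than a constant, so near its lower end every late image
of the ray has diameter at most a constant D. Pulling back m steps gives diameter at most D / 2^m,
so some iterate of the ray converges. Convergence then passes back through E, because a continuous
curve cannot switch between preimages of the limit.

Uniform escape implies fast. If s is slow, let the entries after n be bounded by A times the
iterates of F at x, and take the ray point of potential x + 2 at time n. Its real part there exceeds
x + 3 by a margin, and the small heights force it to keep pace with the iterates of x + 3. This
contradicts the asymptotics, which follow x + 2. -/

/-! ### Algebra of E and its critical values. -/

lemma mul_exp_eq_of_exp_two_mul {a b c : ℂ} (ha : a ≠ 0) (hc : Complex.exp (2 * c) = b / a) :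
    b = a * Complex.exp c * Complex.exp c := by
  rw [mul_assoc, ← Complex.exp_add, ← two_mul, hc, mul_div_cancel₀ _ ha]

lemma critVal₁_eq {a b c : ℂ} (ha : a ≠ 0) (hc : Complex.exp (2 * c) = b / a) :
    critVal₁ a b c = 2 * a * Complex.exp c := by
  have hb := mul_exp_eq_of_exp_two_mul ha hc
  have h0 : Complex.exp c * Complex.exp (-c) = 1 := by rw [← Complex.exp_add]; simp
  unfold critVal₁ cosMap
  linear_combination Complex.exp (-c) * hb + a * Complex.exp c * h0

lemma critVal₂_eq {a b c : ℂ} : critVal₂ a b c = -critVal₁ a b c := by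
  simp only [critVal₁, critVal₂, cosMap, Complex.exp_add, Complex.exp_pi_mul_I, neg_add,
    Complex.exp_neg, inv_neg, inv_one]
  ring

/-- The critical point c makes the right side a perfect square. To the right of c the squared factor
has positive real part, so log(E(z) - v₁) controls z itself. -/
lemma cosMap_sub_critVal₁ {a b c : ℂ} (ha : a ≠ 0) (hc : Complex.exp (2 * c) = b / a) (z : ℂ) :
    cosMap a b z - critVal₁ a b c = a * Complex.exp z * (1 - Complex.exp (c - z)) ^ 2 := by
  have hb := mul_exp_eq_of_exp_two_mul ha hc
  have h0 : Complex.exp z * Complex.exp (-z) = 1 := by rw [← Complex.exp_add]; simp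
  rw [critVal₁_eq ha hc, cosMap, sub_eq_add_neg c, Complex.exp_add]
  linear_combination Complex.exp (-z) * hb +
    (2 * a * Complex.exp c - a * Complex.exp c ^ 2 * Complex.exp (-z)) * h0

/-- This symmetry exchanges the two sides of the critical line, so later estimates need proof only
on the right. -/
lemma cosMap_reflect {a b c : ℂ} (ha : a ≠ 0) (hc : Complex.exp (2 * c) = b / a) (z : ℂ) :
    cosMap a b (2 * c - z) = cosMap a b z := by
  have hb := mul_exp_eq_of_exp_two_mul ha hc
  have h0 : Complex.exp c * Complex.exp (-c) = 1 := by rw [← Complex.exp_add]; simp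
  have h1 : Complex.exp (2 * c - z) = Complex.exp c * Complex.exp c * Complex.exp (-z) := by
    rw [← Complex.exp_add, ← Complex.exp_add]; ring_nf
  have h2 : Complex.exp (-(2 * c - z)) = Complex.exp (-c) * Complex.exp (-c) * Complex.exp z := by
    rw [← Complex.exp_add, ← Complex.exp_add]; ring_nf
  rw [cosMap, cosMap, h1, h2]
  linear_combination (Complex.exp (-c) * Complex.exp (-c) * Complex.exp z - Complex.exp (-z)) * hb
    + a * Complex.exp z * (1 + Complex.exp c * Complex.exp (-c)) * h0

lemma continuous_cosMap (a b : ℂ) : Continuous (cosMap a b) := by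
  unfold cosMap; fun_prop

/-- The preimage of the slit contains the vertical line through the critical points. -/
lemma cosMap_mem_slit_of_re_eq {a b c : ℂ} (ha : a ≠ 0) (hc : Complex.exp (2 * c) = b / a) {z : ℂ}
    (hz : z.re = c.re) : cosMap a b z ∈ slit a b c := by
  have hb := mul_exp_eq_of_exp_two_mul ha hc
  left
  set y : ℝ := z.im - c.im
  have hzy : z = c + y * Complex.I := by
    apply Complex.ext <;> simp [hz, y]
  have hcos : Complex.exp (y * Complex.I) + Complex.exp (-(y * Complex.I)) = 2 * (Real.cos y : ℂ) := by
    rw [Complex.ofReal_cos, Complex.two_cos, neg_mul]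
  have h0 : Complex.exp c * Complex.exp (-c) = 1 := by rw [← Complex.exp_add]; simp
  have hE : cosMap a b z = (Real.cos y : ℂ) * critVal₁ a b c := by
    rw [critVal₁_eq ha hc, cosMap, hzy, neg_add, Complex.exp_add, Complex.exp_add]
    linear_combination a * Complex.exp c * hcos + Complex.exp (-c) *
      Complex.exp (-(y * Complex.I)) * hb + a * Complex.exp c * Complex.exp (-(y * Complex.I)) * h0
  refine ⟨(1 + Real.cos y) / 2, (1 - Real.cos y) / 2, ?_, ?_, by ring, ?_⟩
  · linarith [Real.neg_one_le_cos y]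
  · linarith [Real.cos_le_one y]
  · rw [hE, critVal₂_eq, Complex.real_smul, Complex.real_smul]
    push_cast
    ring

lemma abs_re_le_of_mem_slit {a b c z : ℂ} (hz : z ∈ slit a b c) :
    |z.re| ≤ |(critVal₁ a b c).re| := by
  rcases hz with ⟨x, y, hx, hy, hxy, rfl⟩ | ⟨h, -⟩
  · rw [critVal₂_eq]
    have : (x • critVal₁ a b c + y • -critVal₁ a b c).re = (x - y) * (critVal₁ a b c).re := by
      simp; ring
    rw [this, abs_mul]
    exact mul_le_of_le_one_left (abs_nonneg _) (abs_le.2 ⟨by linarith, by linarith⟩)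
  · rw [h]

/-! ### Heights of preimages, via arguments off the slit. -/

/-- The unimodular factor that turns the ray of the slit into the negative real axis. -/
noncomputable def slitRotation (a b c : ℂ) : ℂ :=
  if (critVal₂ a b c).im ≤ (critVal₁ a b c).im then Complex.I else -Complex.I

lemma slitRotation_mul_mem_slitPlane {a b c z : ℂ} (hz : z ∉ slit a b c) :
    slitRotation a b c * (z - critVal₁ a b c) ∈ Complex.slitPlane := by
  have hz' := fun h => hz (Or.inr h)
  rw [mem_ofPred_eq] at hz'
  rw [Complex.mem_slitPlane_iff]
  unfold slitRotation
  by_cases hre : z.re = (critVal₁ a b c).re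
  · left
    split_ifs with h
    · have : ¬ (critVal₁ a b c).im ≤ z.im := fun h' => hz' ⟨hre, Or.inl ⟨h, h'⟩⟩
      simp; linarith
    · have : ¬ z.im ≤ (critVal₁ a b c).im := fun h' => hz' ⟨hre, Or.inr ⟨not_le.1 h, h'⟩⟩
      simp; linarith
  · right
    split_ifs with h <;> simpa [sub_eq_zero, neg_eq_zero] using fun h' => hre (by linarith)

/-- Points on the same side of the vertical line through `v₁` have arguments differing by at
most `π`. -/
lemma abs_arg_slitRotation_sub_le {a b c x y : ℂ} (h : 0 < x.re * y.re) :
    |(slitRotation a b c * x).arg - (slitRotation a b c * y).arg| ≤ Real.pi := by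
  have key : ∀ u v : ℂ, 0 < u.im * v.im → |u.arg - v.arg| ≤ Real.pi := by
    intro u v huv
    rcases mul_pos_iff.1 huv with ⟨h1, h2⟩ | ⟨h1, h2⟩
    · have := Complex.arg_nonneg_iff.2 h1.le
      have := Complex.arg_nonneg_iff.2 h2.le
      rw [abs_le]
      constructor <;> linarith [Complex.arg_le_pi u, Complex.arg_le_pi v]
    · have := Complex.arg_neg_iff.2 h1
      have := Complex.arg_neg_iff.2 h2
      rw [abs_le]
      constructor <;> linarith [Complex.neg_pi_lt_arg u, Complex.neg_pi_lt_arg v]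
  apply key
  unfold slitRotation
  split_ifs <;> simpa using h

lemma one_sub_exp_re_pos {w : ℂ} (hw : w.re < 0) : 0 < (1 - Complex.exp w).re := by
  have h1 : ‖Complex.exp w‖ < 1 := by rw [Complex.norm_exp]; simpa using hw
  have := (Complex.abs_re_le_norm (Complex.exp w))
  simp only [Complex.sub_re, Complex.one_re]
  linarith [le_abs_self (Complex.exp w).re]

/-- On a connected set to the right of the critical points that `E` maps off the slit, the
imaginary part is determined by arguments. -/
lemma im_sub_im_eq {a b c : ℂ} (ha : a ≠ 0) (hc : Complex.exp (2 * c) = b / a) {S : Set ℂ}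
    (hS : IsPreconnected S) (hE : ∀ z ∈ S, cosMap a b z ∉ slit a b c) (hr : ∀ z ∈ S, c.re < z.re)
    {z z' : ℂ} (hz : z ∈ S) (hz' : z' ∈ S) :
    z.im - z'.im =
      (slitRotation a b c * (cosMap a b z - critVal₁ a b c)).arg -
      (slitRotation a b c * (cosMap a b z' - critVal₁ a b c)).arg -
      2 * ((1 - Complex.exp (c - z)).arg - (1 - Complex.exp (c - z')).arg) := by
  set f : ℂ → ℂ := fun z =>
    Complex.log (slitRotation a b c * (cosMap a b z - critVal₁ a b c)) -
      2 * Complex.log (1 - Complex.exp (c - z)) - z with hf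
  have hpl1 : ∀ z ∈ S, slitRotation a b c * (cosMap a b z - critVal₁ a b c) ∈ Complex.slitPlane :=
    fun z hz => slitRotation_mul_mem_slitPlane (hE z hz)
  have hpl2 : ∀ z ∈ S, 1 - Complex.exp (c - z) ∈ Complex.slitPlane := fun z hz =>
    Or.inl (one_sub_exp_re_pos (by simpa using hr z hz))
  have hcont : ContinuousOn f S := by
    refine ((ContinuousOn.clog ?_ hpl1).sub
      (continuousOn_const.mul (ContinuousOn.clog ?_ hpl2))).sub continuousOn_id
    · exact (continuous_const.mul ((continuous_cosMap a b).sub continuous_const)).continuousOn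
    · fun_prop
  have hexp : ∀ z ∈ S, Complex.exp (f z) = slitRotation a b c * a := by
    intro z hz
    have h1 := Complex.slitPlane_ne_zero (hpl1 z hz)
    have h2 := Complex.slitPlane_ne_zero (hpl2 z hz)
    simp only [hf]
    rw [Complex.exp_sub, Complex.exp_sub, two_mul, Complex.exp_add, Complex.exp_log h1,
      Complex.exp_log h2, cosMap_sub_critVal₁ ha hc]
    field_simp [Complex.exp_ne_zero]
  -- A continuous lift of a constant through exp is constant on a connected set.
  have hconst : f z = f z' := Complex.isCoveringMap_exp.constOn_of_comp hS hcont
    (fun x hx y hy => Subtype.ext ((hexp x hx).trans (hexp y hy).symm)) hz hz'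
  have := congrArg Complex.im hconst
  simp only [hf, Complex.sub_im, Complex.log_im, Complex.mul_im, Complex.re_ofNat,
    Complex.im_ofNat, zero_mul, add_zero] at this
  linarith

/-- Two principal arguments differ by at most 2π, and the doubled arguments from the right
half-plane add at most 2π more. -/
lemma abs_im_sub_im_le {a b c : ℂ} (ha : a ≠ 0) (hc : Complex.exp (2 * c) = b / a) {S : Set ℂ}
    (hS : IsPreconnected S) (hE : ∀ z ∈ S, cosMap a b z ∉ slit a b c) (hr : ∀ z ∈ S, c.re < z.re)
    {z z' : ℂ} (hz : z ∈ S) (hz' : z' ∈ S) : |z.im - z'.im| ≤ 4 * Real.pi := by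
  rw [im_sub_im_eq ha hc hS hE hr hz hz']
  have h1 := abs_le.1 (Complex.abs_arg_le_pi_div_two_iff.2
    (one_sub_exp_re_pos (w := c - z) (by simpa using hr z hz)).le)
  have h2 := abs_le.1 (Complex.abs_arg_le_pi_div_two_iff.2
    (one_sub_exp_re_pos (w := c - z') (by simpa using hr z' hz')).le)
  have h3 := abs_le.1 (Complex.abs_arg_le_pi
    (slitRotation a b c * (cosMap a b z - critVal₁ a b c)))
  have h4 := abs_le.1 (Complex.abs_arg_le_pi
    (slitRotation a b c * (cosMap a b z' - critVal₁ a b c)))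
  rw [abs_le]
  constructor <;> linarith

/-! ### Expansion of E far from the critical line. -/

/-- Jordan's inequality covers [0, π/2]. Beyond it, reflection in π/2 gives sin y ≥ 1/2, while y/5 ≤
3π/20 < 1/2. -/
lemma abs_le_mul_abs_sin {y : ℝ} (hy : |y| ≤ 3 * Real.pi / 4) : |y| / 5 ≤ |Real.sin y| := by
  have key : ∀ y : ℝ, 0 ≤ y → y ≤ 3 * Real.pi / 4 → y / 5 ≤ Real.sin y := by
    intro y h0 h1
    have hpi := Real.pi_pos
    have h4 := Real.pi_lt_d2
    have h3 := Real.pi_gt_three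
    have h2pi : 1 / 2 ≤ 2 / Real.pi := by rw [div_le_div_iff₀] <;> linarith
    rcases le_total y (Real.pi / 2) with h | h
    · have := Real.mul_le_sin h0 h
      nlinarith
    · have h5 := Real.mul_le_sin (x := Real.pi - y) (by linarith) (by linarith)
      rw [Real.sin_pi_sub] at h5
      have h6 : 2 / Real.pi * (Real.pi / 4) ≤ 2 / Real.pi * (Real.pi - y) := by
        gcongr; linarith
      have h7 : 2 / Real.pi * (Real.pi / 4) = 1 / 2 := by field_simp; norm_num
      linarith
  rcases le_total 0 y with h | h
  · rw [abs_of_nonneg h] at *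
    exact (key y h hy).trans (le_abs_self _)
  · rw [abs_of_nonpos h] at *
    have := key (-y) (by linarith) hy
    rw [Real.sin_neg] at this
    exact this.trans (neg_le_abs _)

/-- From |sinh w|² = sinh²(Re w) + sin²(Im w); the bound on Im w keeps w away from the nonzero zeros
iπk. -/
lemma norm_le_norm_sinh {w : ℂ} (hw : |w.im| ≤ 3 * Real.pi / 4) : ‖w‖ / 5 ≤ ‖Complex.sinh w‖ := by
  have hs : ‖Complex.sinh w‖ ^ 2 = Real.sinh w.re ^ 2 + Real.sin w.im ^ 2 := by
    have hw' : Complex.sinh w = ((Real.sinh w.re * Real.cos w.im : ℝ) : ℂ) +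
        ((Real.cosh w.re * Real.sin w.im : ℝ) : ℂ) * Complex.I := by
      conv_lhs => rw [← Complex.re_add_im w, Complex.sinh_add, Complex.sinh_mul_I,
        Complex.cosh_mul_I]
      push_cast
      ring
    rw [Complex.sq_norm, hw', Complex.normSq_add_mul_I]
    have := Real.sin_sq_add_cos_sq w.im
    have h : Real.cos w.im ^ 2 = 1 - Real.sin w.im ^ 2 := by linarith
    linear_combination Real.sin w.im ^ 2 * Real.cosh_sq w.re + Real.sinh w.re ^ 2 * h
  have h1 : |w.re| ≤ |Real.sinh w.re| := by
    rw [Real.abs_sinh]; exact Real.self_le_sinh_iff.2 (abs_nonneg _)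
  have h2 := abs_le_mul_abs_sin hw
  have h3 : ‖w‖ ^ 2 = w.re ^ 2 + w.im ^ 2 := by rw [Complex.sq_norm, Complex.normSq_apply]; ring
  refine (sq_le_sq₀ (by positivity) (norm_nonneg _)).1 ?_
  rw [hs, div_pow, h3]
  have h4 : w.re ^ 2 ≤ Real.sinh w.re ^ 2 := sq_le_sq.2 h1
  have h5 : (w.im / 5) ^ 2 ≤ Real.sin w.im ^ 2 := by
    apply sq_le_sq.2; rwa [abs_div, abs_of_pos (by norm_num : (0:ℝ) < 5)]
  nlinarith [sq_nonneg w.re]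

lemma cosMap_sub_cosMap (a b z z' : ℂ) : cosMap a b z - cosMap a b z' =
    2 * Complex.exp ((z + z') / 2) * Complex.sinh ((z - z') / 2) *
      (a - b * Complex.exp (-(z + z'))) := by
  have h1 : 2 * Complex.exp ((z + z') / 2) * Complex.sinh ((z - z') / 2) =
      Complex.exp z - Complex.exp z' := by
    rw [mul_right_comm, Complex.two_sinh, sub_mul, ← Complex.exp_add, ← Complex.exp_add]
    ring_nf
  have h2 : Complex.exp z * Complex.exp (-(z + z')) = Complex.exp (-z') := by
    rw [← Complex.exp_add]; ring_nf
  have h3 : Complex.exp z' * Complex.exp (-(z + z')) = Complex.exp (-z) := by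
    rw [← Complex.exp_add]; ring_nf
  rw [h1, cosMap, cosMap]
  linear_combination b * (h2 - h3)

lemma exists_expansion_right {a b c : ℂ} (ha : a ≠ 0) (hc : Complex.exp (2 * c) = b / a) :
    ∃ ρ : ℝ, ∀ S : Set ℂ, IsPreconnected S → (∀ z ∈ S, cosMap a b z ∉ slit a b c) →
      (∀ z ∈ S, c.re < z.re) → ∀ z ∈ S, ∀ z' ∈ S, ρ ≤ z.re → ρ ≤ z'.re →
      0 < (cosMap a b z - critVal₁ a b c).re * (cosMap a b z' - critVal₁ a b c).re →
      2 * ‖z - z'‖ ≤ ‖cosMap a b z - cosMap a b z'‖ := by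
  have hpi := Real.pi_pos
  have hna : 0 < ‖a‖ := norm_pos_iff.2 ha
  obtain ⟨ε, hε, hεarg⟩ : ∃ ε > 0, ∀ w : ℂ, ‖w‖ < ε → |(1 - w).arg| < Real.pi / 8 := by
    have h1 : ContinuousAt (fun w : ℂ => |(1 - w).arg|) 0 := by
      refine (ContinuousAt.comp (g := Complex.arg) (f := fun w : ℂ => 1 - w) ?_ (by fun_prop)).abs
      exact Complex.continuousAt_arg (by simp)
    have h2 := h1.eventually_lt (continuousAt_const (y := Real.pi / 8)) (by simpa using hpi)
    obtain ⟨ε, hε, h⟩ := Metric.eventually_nhds_iff.1 h2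
    exact ⟨ε, hε, fun w hw => h (by simpa using hw)⟩
  have e1 : ∀ᶠ x : ℝ in atTop, Real.exp (c.re - x) < ε :=
    (Real.tendsto_exp_atBot.comp (tendsto_const_nhds.add_atBot tendsto_neg_atTop_atBot)).eventually
      (gt_mem_nhds hε)
  have e2 : ∀ᶠ x : ℝ in atTop, ‖b‖ * Real.exp (-(2 * x)) < ‖a‖ / 2 := by
    have : Tendsto (fun x : ℝ => ‖b‖ * Real.exp (-(2 * x))) atTop (𝓝 (‖b‖ * 0)) :=
      (Real.tendsto_exp_neg_atTop_nhds_zero.comp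
        (tendsto_id.const_mul_atTop (by norm_num : (0 : ℝ) < 2))).const_mul _
    exact this.eventually (gt_mem_nhds (by simpa using hna))
  -- The value 20/‖a‖ makes the product of the four factors below equal to 2‖z - z'‖.
  have e3 : ∀ᶠ x : ℝ in atTop, 20 / ‖a‖ ≤ Real.exp x := Real.tendsto_exp_atTop.eventually_ge_atTop _
  obtain ⟨ρ, h1, h2, h3⟩ := (e1.and (e2.and e3)).exists
  refine ⟨ρ, fun S hS hE hr z hz z' hz' hzρ hzρ' hside => ?_⟩
  have harg : ∀ z : ℂ, ρ ≤ z.re → |(1 - Complex.exp (c - z)).arg| < Real.pi / 8 := fun z hz => by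
    apply hεarg
    rw [Complex.norm_exp, Complex.sub_re]
    exact lt_of_le_of_lt (Real.exp_le_exp.2 (by linarith)) h1
  -- Images on the same side contribute at most π, and the four terms of size π/8 at most π/2. Half
  -- of 3π/2 stays short of the zero of sinh at iπ.
  have him : |((z - z') / 2).im| ≤ 3 * Real.pi / 4 := by
    have h4 := im_sub_im_eq ha hc hS hE hr hz hz'
    have h5 := abs_le.1 (abs_arg_slitRotation_sub_le (a := a) (b := b) (c := c) hside)
    have h6 := abs_lt.1 (harg z hzρ)
    have h7 := abs_lt.1 (harg z' hzρ')
    have h8 : ((z - z') / 2).im = (z.im - z'.im) / 2 := by simp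
    rw [h8, abs_le]
    constructor <;> linarith
  have hsinh := norm_le_norm_sinh him
  rw [norm_div, Complex.norm_ofNat] at hsinh
  rw [cosMap_sub_cosMap, norm_mul, norm_mul, norm_mul, Complex.norm_ofNat]
  have hb : ‖a‖ / 2 ≤ ‖a - b * Complex.exp (-(z + z'))‖ := by
    have h4 := norm_sub_norm_le a (b * Complex.exp (-(z + z')))
    have h5 : ‖b * Complex.exp (-(z + z'))‖ ≤ ‖b‖ * Real.exp (-(2 * ρ)) := by
      rw [norm_mul, Complex.norm_exp]
      gcongr
      simp only [Complex.neg_re, Complex.add_re]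
      linarith
    linarith
  have he : 20 / ‖a‖ ≤ ‖Complex.exp ((z + z') / 2)‖ := by
    refine h3.trans ?_
    rw [Complex.norm_exp, Real.exp_le_exp]
    have : ((z + z') / 2).re = (z.re + z'.re) / 2 := by simp
    rw [this]
    linarith
  calc 2 * ‖z - z'‖ = 2 * (20 / ‖a‖) * (‖z - z'‖ / 2 / 5) * (‖a‖ / 2) := by
        field_simp; ring
    _ ≤ _ := by gcongr

lemma exists_expansion {a b c : ℂ} (ha : a ≠ 0) (hc : Complex.exp (2 * c) = b / a) :
    ∃ ρ : ℝ, ∀ S : Set ℂ, IsPreconnected S → (∀ z ∈ S, cosMap a b z ∉ slit a b c) →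
      ((∀ z ∈ S, c.re < z.re) ∨ (∀ z ∈ S, z.re < c.re)) →
      ∀ z ∈ S, ∀ z' ∈ S, ρ ≤ |z.re| → ρ ≤ |z'.re| →
      0 < (cosMap a b z - critVal₁ a b c).re * (cosMap a b z' - critVal₁ a b c).re →
      2 * ‖z - z'‖ ≤ ‖cosMap a b z - cosMap a b z'‖ := by
  obtain ⟨ρ, hρ⟩ := exists_expansion_right ha hc
  refine ⟨|ρ| + 2 * |c.re| + 1, fun S hS hE hside z hz z' hz' hzρ hzρ' hpos => ?_⟩
  have hc1 := le_abs_self c.re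
  have hc2 := neg_abs_le c.re
  have hr := le_abs_self ρ
  have hr0 := abs_nonneg ρ
  have hc0 := abs_nonneg c.re
  rcases hside with h | h
  · have key : ∀ z ∈ S, |ρ| + 2 * |c.re| + 1 ≤ |z.re| → ρ ≤ z.re := by
      intro z hz hzρ
      have := h z hz
      rcases abs_cases z.re with ⟨h1, h2⟩ | ⟨h1, h2⟩ <;> linarith
    exact hρ S hS hE h z hz z' hz' (key z hz hzρ) (key z' hz' hzρ') hpos
  · have key : ∀ z ∈ S, |ρ| + 2 * |c.re| + 1 ≤ |z.re| → ρ ≤ (2 * c - z).re := by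
      intro z hz hzρ
      have := h z hz
      have h3 : (2 * c - z).re = 2 * c.re - z.re := by simp
      rw [h3]
      rcases abs_cases z.re with ⟨h1, h2⟩ | ⟨h1, h2⟩ <;> linarith
    have := hρ ((fun z => 2 * c - z) '' S) (hS.image _ (by fun_prop))
      (by rintro _ ⟨x, hx, rfl⟩; rw [cosMap_reflect ha hc]; exact hE x hx)
      (by rintro _ ⟨x, hx, rfl⟩; have := h x hx; simp; linarith)
      (2 * c - z) ⟨z, hz, rfl⟩ (2 * c - z') ⟨z', hz', rfl⟩ (key z hz hzρ) (key z' hz' hzρ')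
      (by rw [cosMap_reflect ha hc, cosMap_reflect ha hc]; exact hpos)
    rw [cosMap_reflect ha hc, cosMap_reflect ha hc, sub_sub_sub_cancel_left, norm_sub_rev] at this
    exact this

/-! ### Geometry of the strips. -/

variable {a b c : ℂ} {strip : ℤ × Side → Set ℂ}

lemma IsStripLabelling.isPreconnected (h : IsStripLabelling a b c strip) (j : ℤ × Side) :
    IsPreconnected (strip j) := by
  obtain ⟨z, -, hz⟩ := h.component j
  rw [hz]
  exact isPreconnected_connectedComponentIn

lemma IsStripLabelling.notMem_slit (h : IsStripLabelling a b c strip) {j : ℤ × Side} {z : ℂ}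
    (hz : z ∈ strip j) : cosMap a b z ∉ slit a b c := by
  obtain ⟨z₀, -, hz₀⟩ := h.component j
  rw [hz₀] at hz
  exact connectedComponentIn_subset _ _ hz

/-- A connected set that `E` maps off the slit and that meets a strip lies in that strip. -/
lemma IsStripLabelling.subset_of_isPreconnected (h : IsStripLabelling a b c strip) {j : ℤ × Side}
    {K : Set ℂ} (hK : IsPreconnected K) (hE : ∀ z ∈ K, cosMap a b z ∉ slit a b c)
    {z : ℂ} (hz : z ∈ K) (hzj : z ∈ strip j) : K ⊆ strip j := by
  obtain ⟨z₀, -, hz₀⟩ := h.component j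
  rw [hz₀] at hzj ⊢
  rw [connectedComponentIn_eq hzj]
  exact hK.subset_connectedComponentIn hz hE

lemma IsStripLabelling.mem_iff_sub (h : IsStripLabelling a b c strip) (n : ℤ) (d : Side) (z : ℂ) :
    z ∈ strip (n, d) ↔ z - 2 * Real.pi * Complex.I * n ∈ strip (0, d) := by
  induction n generalizing z with
  | zero => simp
  | succ n ih =>
    have := h.translate n d (z - 2 * Real.pi * Complex.I)
    rw [sub_add_cancel] at this
    rw [← this, ih]
    push_cast
    ring_nf
  | pred n ih =>
    have := h.translate (-(n : ℤ) - 1) d z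
    rw [sub_add_cancel] at this
    rw [this, ih]
    push_cast
    ring_nf

lemma re_lt_or_of_isPreconnected (ha : a ≠ 0) (hc : Complex.exp (2 * c) = b / a) {S : Set ℂ}
    (hS : IsPreconnected S) (hE : ∀ z ∈ S, cosMap a b z ∉ slit a b c) :
    (∀ z ∈ S, c.re < z.re) ∨ (∀ z ∈ S, z.re < c.re) := by
  by_contra! hcon
  obtain ⟨⟨z, hz, hz1⟩, z', hz', hz1'⟩ := hcon
  obtain ⟨x, hx, hx1⟩ := hS.intermediate_value hz hz' Complex.continuous_re.continuousOn ⟨hz1, hz1'⟩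
  exact hE x hx (cosMap_mem_slit_of_re_eq ha hc hx1)

lemma IsStripLabelling.re_lt_or (h : IsStripLabelling a b c strip) (ha : a ≠ 0)
    (hc : Complex.exp (2 * c) = b / a) (j : ℤ × Side) :
    (∀ z ∈ strip j, c.re < z.re) ∨ (∀ z ∈ strip j, z.re < c.re) :=
  re_lt_or_of_isPreconnected ha hc (h.isPreconnected j) fun _ => h.notMem_slit

lemma IsStripLabelling.exists_abs_im_lt_one (h : IsStripLabelling a b c strip) (d : Side) :
    ∃ z ∈ strip (0, d), |z.im| < 1 := by
  have key : ∀ x : ℝ, (x : ℂ) ∈ closure (strip (0, d)) → ∃ z ∈ strip (0, d), |z.im| < 1 := by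
    intro x hx
    obtain ⟨z, hz, hzx⟩ := Metric.mem_closure_iff.1 hx 1 one_pos
    refine ⟨z, hz, ?_⟩
    have := Complex.abs_im_le_norm ((x : ℂ) - z)
    rw [Complex.sub_im, Complex.ofReal_im, zero_sub, abs_neg] at this
    exact this.trans_lt (by rwa [← dist_eq_norm])
  cases d
  · obtain ⟨x, hx⟩ := h.left_end
    exact key x (hx x le_rfl)
  · obtain ⟨x, hx⟩ := h.right_end
    exact key x (hx x le_rfl)

/-- Translation reduces to n = 0, where the strip comes within height 1 of the real line and has
vertical extent at most 4π. -/
lemma IsStripLabelling.abs_im_sub_le (h : IsStripLabelling a b c strip) (ha : a ≠ 0)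
    (hc : Complex.exp (2 * c) = b / a) {n : ℤ} {d : Side} {z : ℂ} (hz : z ∈ strip (n, d)) :
    |z.im - 2 * Real.pi * n| ≤ 4 * Real.pi + 1 := by
  obtain ⟨x, hx, hx1⟩ := h.exists_abs_im_lt_one d
  rw [h.mem_iff_sub] at hz
  have him : (z - 2 * Real.pi * Complex.I * n).im = z.im - 2 * Real.pi * n := by simp
  have key : |(z - 2 * Real.pi * Complex.I * n).im - x.im| ≤ 4 * Real.pi := by
    have hE : ∀ z ∈ strip (0, d), cosMap a b z ∉ slit a b c := fun _ => h.notMem_slit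
    rcases h.re_lt_or ha hc (0, d) with hr | hr
    · exact abs_im_sub_im_le ha hc (h.isPreconnected _) hE hr hz hx
    · have := abs_im_sub_im_le ha hc (S := (fun z => 2 * c - z) '' strip (0, d))
        ((h.isPreconnected _).image _ (by fun_prop))
        (by rintro _ ⟨x, hx, rfl⟩; rw [cosMap_reflect ha hc]; exact hE x hx)
        (by rintro _ ⟨x, hx, rfl⟩; have := hr x hx; simp; linarith) ⟨_, hx, rfl⟩ ⟨_, hz, rfl⟩
      simp only [Complex.sub_im] at this ⊢
      rwa [sub_sub_sub_cancel_left] at this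
  rw [him] at key
  rw [abs_le] at key ⊢
  have := abs_lt.1 hx1
  constructor <;> linarith

/-- `E` expands distances by a factor of two between points of the same strip, if they and their
images, which are in a common strip, have large real parts. -/
lemma IsStripLabelling.exists_expansion (h : IsStripLabelling a b c strip) (ha : a ≠ 0)
    (hc : Complex.exp (2 * c) = b / a) :
    ∃ ρ : ℝ, ∀ j j' : ℤ × Side, ∀ z ∈ strip j, ∀ z' ∈ strip j, cosMap a b z ∈ strip j' →
      cosMap a b z' ∈ strip j' → ρ ≤ |z.re| → ρ ≤ |z'.re| → ρ ≤ |(cosMap a b z).re| →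
      ρ ≤ |(cosMap a b z').re| → 2 * ‖z - z'‖ ≤ ‖cosMap a b z - cosMap a b z'‖ := by
  obtain ⟨ρ, hρ⟩ := CosineRays.exists_expansion ha hc
  refine ⟨max ρ (|c.re| + |(critVal₁ a b c).re| + 1),
    fun j j' z hz z' hz' hE hE' h1 h2 h3 h4 => ?_⟩
  refine hρ _ (h.isPreconnected j) (fun _ => h.notMem_slit) (h.re_lt_or ha hc j) z hz z' hz'
    ((le_max_left _ _).trans h1) ((le_max_left _ _).trans h2) ?_
  replace h3 := (le_max_right _ _).trans h3
  replace h4 := (le_max_right _ _).trans h4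
  have hc1 := abs_le.1 (le_refl |c.re|)
  have hv := abs_le.1 (le_refl |(critVal₁ a b c).re|)
  have hc0 := abs_nonneg c.re
  have hv0 := abs_nonneg (critVal₁ a b c).re
  rw [Complex.sub_re, Complex.sub_re]
  rcases h.re_lt_or ha hc j' with hr | hr
  · have := hr _ hE
    have := hr _ hE'
    apply mul_pos
    · rcases abs_cases (cosMap a b z).re with ⟨h5, h6⟩ | ⟨h5, h6⟩ <;> linarith
    · rcases abs_cases (cosMap a b z').re with ⟨h5, h6⟩ | ⟨h5, h6⟩ <;> linarith
  · have := hr _ hE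
    have := hr _ hE'
    apply mul_pos_of_neg_of_neg
    · rcases abs_cases (cosMap a b z).re with ⟨h5, h6⟩ | ⟨h5, h6⟩ <;> linarith
    · rcases abs_cases (cosMap a b z').re with ⟨h5, h6⟩ | ⟨h5, h6⟩ <;> linarith

/-! ### Exponential size of E. -/

lemma norm_cosMap_le (a b z : ℂ) : ‖cosMap a b z‖ ≤ (‖a‖ + ‖b‖) * Real.exp |z.re| := by
  unfold cosMap
  refine (norm_add_le _ _).trans ?_
  rw [norm_mul, norm_mul, Complex.norm_exp, Complex.norm_exp, add_mul, Complex.neg_re]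
  gcongr
  · exact le_abs_self _
  · exact neg_le_abs _

lemma exists_le_norm_cosMap (ha : a ≠ 0) (hb : b ≠ 0) :
    ∃ k > 0, ∃ ρ : ℝ, ∀ z : ℂ, ρ ≤ |z.re| → k * Real.exp |z.re| ≤ ‖cosMap a b z‖ := by
  have hna : 0 < ‖a‖ := norm_pos_iff.2 ha
  have hnb : 0 < ‖b‖ := norm_pos_iff.2 hb
  have key : ∀ a b : ℂ, 0 < ‖a‖ → ∀ᶠ x : ℝ in atTop, ∀ z w : ℂ, z.re = x → w.re = -x →
      ‖a‖ / 2 * Real.exp x ≤ ‖a * Complex.exp z + b * Complex.exp w‖ := by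
    intro a b ha
    have e2 : ∀ᶠ x : ℝ in atTop, ‖b‖ * Real.exp (-(2 * x)) < ‖a‖ / 2 := by
      have : Tendsto (fun x : ℝ => ‖b‖ * Real.exp (-(2 * x))) atTop (𝓝 (‖b‖ * 0)) :=
        (Real.tendsto_exp_neg_atTop_nhds_zero.comp
          (tendsto_id.const_mul_atTop (by norm_num : (0 : ℝ) < 2))).const_mul _
      exact this.eventually (gt_mem_nhds (by simpa using ha))
    filter_upwards [e2] with x hx z w hz hw
    have h1 := norm_sub_le_norm_add (a * Complex.exp z) (b * Complex.exp w)
    rw [norm_mul, norm_mul, Complex.norm_exp, Complex.norm_exp, hz, hw] at h1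
    have h2 : Real.exp (-x) = Real.exp (-(2 * x)) * Real.exp x := by
      rw [← Real.exp_add]; ring_nf
    have h3 := mul_le_mul_of_nonneg_right hx.le (Real.exp_pos x).le
    rw [h2] at h1
    linarith
  obtain ⟨ρ, hρ⟩ := eventually_atTop.1 ((key a b hna).and (key b a hnb))
  refine ⟨min (‖a‖ / 2) (‖b‖ / 2), by positivity, ρ, fun z hz => ?_⟩
  obtain ⟨h1, h2⟩ := hρ _ hz
  have h0 := (Real.exp_pos |z.re|).le
  rcases abs_cases z.re with ⟨h, -⟩ | ⟨h, -⟩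
  · refine (mul_le_mul_of_nonneg_right (min_le_left _ _) h0).trans (h1 z (-z) h.symm ?_)
    simp [h]
  · refine (mul_le_mul_of_nonneg_right (min_le_right _ _) h0).trans
      ((h2 (-z) z (by simp [h]) (by simp [h])).trans_eq ?_)
    rw [cosMap, add_comm]

/-! ### Iteration of the model map -/

lemma F_strictMono : StrictMono F := fun _ _ h => sub_lt_sub_right (Real.exp_lt_exp.2 h) 1

lemma F_iterate_strictMono (k : ℕ) : StrictMono F^[k] := F_strictMono.iterate k

lemma le_F (x : ℝ) : x ≤ F x := by unfold F; linarith [Real.add_one_le_exp x]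

lemma le_F_iterate (k : ℕ) (x : ℝ) : x ≤ F^[k] x :=
  Function.id_le_iterate_of_id_le (fun x => le_F x) k x

lemma exists_F_iterate_eq (n : ℕ) {y : ℝ} (hy : 0 < y) : ∃ t, 0 < t ∧ F^[n] t = y := by
  induction n generalizing y with
  | zero => exact ⟨y, hy, rfl⟩
  | succ n ih =>
    obtain ⟨t, ht, h⟩ := ih (y := Real.log (1 + y)) (Real.log_pos (by linarith))
    refine ⟨t, ht, ?_⟩
    rw [Function.iterate_succ_apply', h, F, Real.exp_log (by linarith)]
    ring

/-- On [x, ∞) the map F expands by at least 1 + x, so the gap grows geometrically. -/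
lemma tendsto_F_iterate_sub {x y : ℝ} (hx : 0 < x) (hxy : x < y) :
    Tendsto (fun k => F^[k] y - F^[k] x) atTop atTop := by
  have h : ∀ k : ℕ, (1 + x) ^ k * (y - x) ≤ F^[k] y - F^[k] x := by
    intro k
    induction k with
    | zero => simp
    | succ k ih =>
      rw [Function.iterate_succ_apply', Function.iterate_succ_apply']
      set u := F^[k] x
      set v := F^[k] y
      have hu : x ≤ u := le_F_iterate k x
      have hd : 0 ≤ v - u := (F_iterate_strictMono k).monotone hxy.le |> sub_nonneg.2
      have h1 := Real.add_one_le_exp u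
      have h2 := Real.add_one_le_exp (v - u)
      have h3 : F v - F u = Real.exp u * (Real.exp (v - u) - 1) := by
        unfold F
        rw [mul_sub, ← Real.exp_add]
        ring_nf
      rw [h3, pow_succ]
      calc (1 + x) ^ k * (1 + x) * (y - x) = (1 + x) * ((1 + x) ^ k * (y - x)) := by ring
        _ ≤ (1 + x) * (v - u) := by gcongr
        _ ≤ Real.exp u * (Real.exp (v - u) - 1) :=
          mul_le_mul (by linarith) (by linarith) hd (Real.exp_pos u).le
  refine tendsto_atTop_mono h ?_
  exact (tendsto_pow_atTop_atTop_of_one_lt (by linarith)).atTop_mul_const (by linarith)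

/-- One application of F turns the diverging gap into a ratio at most exp(-gap), hence the index
shift. -/
lemma tendsto_F_iterate_div {x y : ℝ} (hx : 0 < x) (hxy : x < y) :
    Tendsto (fun k => F^[k] x / F^[k] y) atTop (𝓝 0) := by
  rw [← tendsto_add_atTop_iff_nat 1]
  refine squeeze_zero (g := fun k => Real.exp (-(F^[k] y - F^[k] x))) (fun k => ?_) (fun k => ?_)
    (Real.tendsto_exp_neg_atTop_nhds_zero.comp (tendsto_F_iterate_sub hx hxy))
  · have h1 := le_F_iterate (k + 1) x
    have h2 := le_F_iterate (k + 1) y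
    exact div_nonneg (by linarith) (by linarith)
  · rw [div_le_iff₀ (by linarith [le_F_iterate (k + 1) y]), Function.iterate_succ_apply',
      Function.iterate_succ_apply']
    have h0 := (F_iterate_strictMono k) hxy
    set u := F^[k] x
    set v := F^[k] y
    have h3 : Real.exp (-(v - u)) ≤ 1 := Real.exp_le_one_iff.2 (by linarith)
    have h4 : Real.exp (-(v - u)) * Real.exp v = Real.exp u := by
      rw [← Real.exp_add]; ring_nf
    unfold F
    rw [mul_sub, h4]
    linarith

/-! ### Potentials -/

lemma shift_iterate_apply (s : Address) (n k : ℕ) : (shift^[n] s) k = s (n + k) := by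
  induction n generalizing s with
  | zero => simp
  | succ n ih => rw [Function.iterate_succ_apply, ih]; unfold shift; congr 1; ring

lemma minPotential_nonneg (s : Address) : 0 ≤ minPotential s :=
  Real.sInf_nonneg fun _ h => h.1.le

lemma minPotential_le {s : Address} {t : ℝ} (ht : 0 < t)
    (h : Tendsto (fun k : ℕ => entryAbs (s k) / F^[k] t) atTop (𝓝 0)) : minPotential s ≤ t :=
  csInf_le ⟨0, fun _ h => h.1.le⟩ ⟨ht, h⟩

lemma minPotential_le_of_le {s : Address} {A x t : ℝ} {n : ℕ} (hx : 0 < x)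
    (h : ∀ k, entryAbs (s (n + k)) ≤ A * F^[k] x) (ht : 0 < t) (hxt : x < F^[n] t) :
    minPotential s ≤ t := by
  apply minPotential_le ht
  rw [← tendsto_add_atTop_iff_nat n]
  have h0 := (tendsto_F_iterate_div hx hxt).const_mul A
  rw [mul_zero] at h0
  refine squeeze_zero (fun k => ?_) (fun k => ?_) h0
  · exact div_nonneg (abs_nonneg _) (by linarith [le_F_iterate (k + n) t])
  · rw [Function.iterate_add_apply, add_comm k n, ← mul_div_assoc]
    have := le_F_iterate k (F^[n] t)
    gcongr
    · linarith
    · exact h k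

lemma ExponentiallyBounded.tendsto_of_lt {s : Address} (hs : ExponentiallyBounded s) {t : ℝ}
    (ht : minPotential s < t) : Tendsto (fun k : ℕ => entryAbs (s k) / F^[k] t) atTop (𝓝 0) := by
  have hne : {t : ℝ | 0 < t ∧
      Tendsto (fun k : ℕ => entryAbs (s k) / F^[k] t) atTop (𝓝 0)}.Nonempty := by
    obtain ⟨x, hx, h⟩ := hs
    refine ⟨x + 1, by linarith, squeeze_zero (fun k => ?_) (fun k => ?_)
      (tendsto_F_iterate_div hx (lt_add_one x))⟩
    · exact div_nonneg (abs_nonneg _) (by linarith [le_F_iterate k (x + 1)])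
    · have := le_F_iterate k (x + 1)
      gcongr
      · linarith
      · exact h k
  obtain ⟨u, ⟨hu, hlim⟩, hut⟩ := exists_lt_of_csInf_lt hne ht
  refine squeeze_zero (fun k => ?_) (fun k => ?_) hlim
  · exact div_nonneg (abs_nonneg _) (by linarith [le_F_iterate k t])
  · have := le_F_iterate k u
    have := (F_iterate_strictMono k) hut
    exact div_le_div_of_nonneg_left (abs_nonneg _) (by linarith) this.le

lemma ExponentiallyBounded.minPotential_shift_lt {s : Address} (hs : ExponentiallyBounded s)
    {t : ℝ} (ht : minPotential s < t) : minPotential (shift s) < F t := by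
  obtain ⟨u, hu, hut⟩ := exists_between ht
  have hu0 : 0 < u := (minPotential_nonneg s).trans_lt hu
  refine (minPotential_le (hu0.trans_le (le_F u)) ?_).trans_lt (F_strictMono hut)
  exact (tendsto_add_atTop_iff_nat 1).2 (hs.tendsto_of_lt hu)

lemma ExponentiallyBounded.shift {s : Address} (hs : ExponentiallyBounded s) :
    ExponentiallyBounded (shift s) := by
  obtain ⟨x, hx, h⟩ := hs
  exact ⟨F x, hx.trans_le (le_F x), fun k => h (k + 1)⟩

lemma ExponentiallyBounded.minPotential_iterate_lt {s : Address} (hs : ExponentiallyBounded s)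
    {t : ℝ} (ht : minPotential s < t) (n : ℕ) : minPotential (CosineRays.shift^[n] s) < F^[n] t := by
  induction n generalizing s t with
  | zero => exact ht
  | succ n ih => exact ih hs.shift (hs.minPotential_shift_lt ht)

/-! ### What is used about a dynamic ray -/

/-- A curve whose points eventually follow the strips of `s`, locally uniformly in the potential,
with real parts of the size of the iterates of the model map. -/
structure FollowsAddress (a b : ℂ) (strip : ℤ × Side → Set ℂ) (s : Address) (g : ℝ → ℂ) :
    Prop where
  continuousOn : ContinuousOn g (Ioi (minPotential s))
  exists_mem_strip : ∀ n t, minPotential s < t → ∃ T, t ≤ T ∧ (cosMap a b)^[n] (g T) ∈ strip (s n)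
  eventually_mem_strip : ∀ t, minPotential s < t →
    ∀ᶠ n : ℕ in atTop, ∀ u, t ≤ u → (cosMap a b)^[n] (g u) ∈ strip (s n)
  asymptotics : ∀ t, minPotential s < t →
    ∃ C : ℝ, ∀ᶠ n : ℕ in atTop, |(|((cosMap a b)^[n] (g t)).re|) - F^[n] t| ≤ C

variable {s : Address} {g : ℝ → ℂ}

lemma IsRayOrbit.iterate_eq {G : ℕ → ℝ → ℂ} (hG : IsRayOrbit a b c strip s G)
    (hs : ExponentiallyBounded s) {t : ℝ} (ht : minPotential s < t) (n : ℕ) :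
    (cosMap a b)^[n] (G 0 t) = G n (F^[n] t) := by
  induction n with
  | zero => rfl
  | succ n ih =>
    rw [Function.iterate_succ_apply', ih, hG.map_eq n _ (hs.minPotential_iterate_lt ht n),
      Function.iterate_succ_apply']

lemma IsDynamicRay.followsAddress (hg : IsDynamicRay a b c strip s g)
    (hs : ExponentiallyBounded s) : FollowsAddress a b strip s g := by
  obtain ⟨G, hG, rfl⟩ := hg
  refine ⟨hG.continuousOn 0, fun n t ht => ?_, fun t ht => ?_, fun t ht => ?_⟩
  · obtain ⟨τ, -, hτ⟩ := hG.extends_tail n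
    refine ⟨max t τ, le_max_left _ _, ?_⟩
    rw [hG.iterate_eq hs (ht.trans_le (le_max_left _ _))]
    have := (hτ.address (F^[n] (max t τ)) ((le_max_right _ _).trans (le_F_iterate _ _))).2 0
    rwa [shift_iterate_apply] at this
  · filter_upwards [hG.eventually_tail t ht] with n hn u hu
    rw [hG.iterate_eq hs (ht.trans_le hu)]
    have := (hn.address (F^[n] u) ((F_iterate_strictMono n).monotone hu)).2 0
    rwa [shift_iterate_apply] at this
  · obtain ⟨n, hn⟩ := (hG.eventually_tail t ht).exists
    obtain ⟨C, hC⟩ := hn.asymptotics _ le_rfl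
    refine ⟨C, eventually_atTop.2 ⟨n, fun m hm => ?_⟩⟩
    obtain ⟨k, rfl⟩ := Nat.exists_eq_add_of_le' hm
    have hpos : 0 ≤ F^[k] (F^[n] t) :=
      ((minPotential_nonneg s).trans ht.le).trans ((le_F_iterate _ _).trans (le_F_iterate _ _))
    have h1 := (Complex.abs_re_le_norm _).trans (hC k)
    rw [← hG.iterate_eq hs ht n, ← Function.iterate_add_apply] at h1
    rw [Function.iterate_add_apply F]
    have h2 : (2 * Real.pi * Complex.I * (((shift^[n] s) k).1 : ℂ)).re = 0 := by simp
    rw [Complex.sub_re, Complex.add_re, h2, add_zero, Complex.ofReal_re] at h1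
    have h3 : |((shift^[n] s) k).2.sign * F^[k] (F^[n] t)| = F^[k] (F^[n] t) := by
      rw [abs_mul, abs_of_nonneg hpos]
      cases ((shift^[n] s) k).2 <;> simp [Side.sign]
    have h4 := abs_abs_sub_abs_le ((cosMap a b)^[k + n] (G 0 t)).re
      (((shift^[n] s) k).2.sign * F^[k] (F^[n] t))
    rw [h3] at h4
    exact h4.trans h1

/-! ### Limits of curves under pull-back -/

/-- A switch between the two points would pass through a point equidistant from both, where the
product has norm at least (d/2)². -/
lemma tendsto_or_of_mul_sub_tendsto_zero {u : ℝ → ℂ} {t₀ : ℝ} (hu : ContinuousOn u (Ioi t₀))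
    {u₁ u₂ : ℂ} (h : Tendsto (fun t => (u t - u₁) * (u t - u₂)) (𝓝[>] t₀) (𝓝 0)) :
    Tendsto u (𝓝[>] t₀) (𝓝 u₁) ∨ Tendsto u (𝓝[>] t₀) (𝓝 u₂) := by
  rcases eq_or_ne u₁ u₂ with rfl | hne
  · left
    rw [tendsto_iff_norm_sub_tendsto_zero]
    have h1 := (Real.continuous_sqrt.tendsto _).comp h.norm
    rw [norm_zero, Real.sqrt_zero] at h1
    refine h1.congr fun t => ?_
    simp [Real.sqrt_mul_self]
  set d := ‖u₁ - u₂‖ with hd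
  have hd0 : 0 < d := norm_pos_iff.2 (sub_ne_zero.2 hne)
  have htri : ∀ t, d ≤ ‖u t - u₁‖ + ‖u t - u₂‖ := fun t => by
    rw [hd, norm_sub_rev (u t)]
    exact norm_sub_le_norm_sub_add_norm_sub u₁ (u t) u₂
  have hev : ∀ᶠ t in 𝓝[>] t₀, ‖(u t - u₁) * (u t - u₂)‖ < d / 2 * (d / 2) := by
    have := h.norm
    rw [norm_zero] at this
    exact this.eventually (gt_mem_nhds (by positivity))
  obtain ⟨δ, hδ, hδev⟩ := mem_nhdsGT_iff_exists_Ioo_subset.1 hev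
  have hclose : ∀ v₁ v₂ : ℂ, (∀ t, d ≤ ‖u t - v₁‖ + ‖u t - v₂‖) →
      Tendsto (fun t => (u t - v₁) * (u t - v₂)) (𝓝[>] t₀) (𝓝 0) →
      (∀ t ∈ Ioo t₀ δ, ‖u t - v₁‖ ≤ ‖u t - v₂‖) → Tendsto u (𝓝[>] t₀) (𝓝 v₁) := by
    intro v₁ v₂ htri h hle
    rw [tendsto_iff_norm_sub_tendsto_zero]
    have h1 := h.norm.mul_const (2 / d)
    rw [norm_zero, zero_mul] at h1
    refine squeeze_zero' (Eventually.of_forall fun _ => norm_nonneg _) ?_ h1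
    filter_upwards [Ioo_mem_nhdsGT hδ] with t ht
    have h2 : d / 2 ≤ ‖u t - v₂‖ := by linarith [htri t, hle t ht]
    rw [norm_mul, mul_assoc]
    refine le_mul_of_one_le_right (norm_nonneg _) ?_
    rw [← mul_div_assoc, le_div_iff₀ hd0]
    linarith
  have hcont : ContinuousOn (fun t => ‖u t - u₁‖ - ‖u t - u₂‖) (Ioo t₀ δ) := by
    have := hu.mono (show Ioo t₀ δ ⊆ Ioi t₀ from Ioo_subset_Ioi_self)
    exact (this.sub continuousOn_const).norm.sub (this.sub continuousOn_const).norm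
  by_cases hall : ∀ t ∈ Ioo t₀ δ, ‖u t - u₁‖ ≤ ‖u t - u₂‖
  · exact Or.inl (hclose u₁ u₂ htri h hall)
  · right
    refine hclose u₂ u₁ (fun t => by rw [add_comm]; exact htri t) (by simpa only [mul_comm] using h) ?_
    by_contra hall'
    push Not at hall hall'
    obtain ⟨x, hx, hx1⟩ := hall
    obtain ⟨y, hy, hy1⟩ := hall'
    obtain ⟨t, ht, ht0⟩ := isPreconnected_Ioo.intermediate_value hy hx hcont
      (show (0 : ℝ) ∈ Icc _ _ from ⟨by linarith, by linarith⟩)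
    have h1 := hδev ht
    rw [mem_ofPred_eq, norm_mul] at h1
    have h2 := htri t
    have h3 : ‖u t - u₁‖ = ‖u t - u₂‖ := sub_eq_zero.1 ht0
    have h4 : d / 2 ≤ ‖u t - u₂‖ := by linarith
    rw [h3] at h1
    exact absurd (mul_le_mul h4 h4 (by positivity) (norm_nonneg _)) (not_le.2 h1)

lemma exists_tendsto_of_exp_tendsto {γ : ℝ → ℂ} {t₀ : ℝ} (hγ : ContinuousOn γ (Ioi t₀)) {u₀ : ℂ}
    (hu₀ : u₀ ≠ 0) (h : Tendsto (fun t => Complex.exp (γ t)) (𝓝[>] t₀) (𝓝 u₀)) :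
    ∃ w, Tendsto γ (𝓝[>] t₀) (𝓝 w) := by
  have h1 : Tendsto (fun t => Complex.exp (γ t) / u₀) (𝓝[>] t₀) (𝓝 1) := by
    simpa [hu₀] using h.div_const u₀
  have hlog := (continuousAt_clog Complex.one_mem_slitPlane).tendsto.comp h1
  rw [Complex.log_one] at hlog
  obtain ⟨δ, hδ, hδev⟩ := mem_nhdsGT_iff_exists_Ioo_subset.1
    (h1.eventually (Complex.isOpen_slitPlane.mem_nhds Complex.one_mem_slitPlane))
  set f : ℝ → ℂ := fun t => γ t - Complex.log (Complex.exp (γ t) / u₀) with hf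
  have hγ' := hγ.mono (show Ioo t₀ δ ⊆ Ioi t₀ from Ioo_subset_Ioi_self)
  have hcont : ContinuousOn f (Ioo t₀ δ) :=
    hγ'.sub (ContinuousOn.clog (hγ'.cexp.div_const _) hδev)
  have hexp : ∀ t, Complex.exp (f t) = u₀ := fun t => by
    rw [hf, Complex.exp_sub, Complex.exp_log (div_ne_zero (Complex.exp_ne_zero _) hu₀)]
    field_simp [Complex.exp_ne_zero]
  obtain ⟨t₁, ht₁⟩ := nonempty_Ioo.2 (mem_Ioi.1 hδ)
  refine ⟨f t₁ + 0, (tendsto_const_nhds.add hlog).congr' ?_⟩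
  filter_upwards [Ioo_mem_nhdsGT hδ] with t ht
  have : f t₁ = f t := Complex.isCoveringMap_exp.constOn_of_comp isPreconnected_Ioo hcont
    (fun x _ y _ => Subtype.ext ((hexp x).trans (hexp y).symm)) ht₁ ht
  rw [this, hf]
  simp

/-- If the image of a curve under `E` converges at an end, then so does the curve. -/
lemma exists_tendsto_of_cosMap_tendsto {a b : ℂ} (ha : a ≠ 0) (hb : b ≠ 0) {γ : ℝ → ℂ} {t₀ : ℝ}
    (hγ : ContinuousOn γ (Ioi t₀)) {w : ℂ}
    (h : Tendsto (fun t => cosMap a b (γ t)) (𝓝[>] t₀) (𝓝 w)) :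
    ∃ w', Tendsto γ (𝓝[>] t₀) (𝓝 w') := by
  obtain ⟨k, hk, ρ, hρ⟩ := exists_le_norm_cosMap ha hb
  set M := max (Real.exp ρ) ((‖w‖ + 1) / k)
  have hM : 0 < M := (Real.exp_pos ρ).trans_le (le_max_left _ _)
  have hbd : ∀ᶠ t in 𝓝[>] t₀, Real.exp |(γ t).re| ≤ M := by
    filter_upwards [h.norm.eventually (gt_mem_nhds (lt_add_one ‖w‖))] with t ht
    rcases le_total ρ |(γ t).re| with h1 | h1
    · refine le_trans ?_ (le_max_right _ _)
      rw [le_div_iff₀' hk]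
      exact (hρ _ h1).trans ht.le
    · exact (Real.exp_le_exp.2 h1).trans (le_max_left _ _)
  have hup : ∀ᶠ t in 𝓝[>] t₀, ‖Complex.exp (γ t)‖ ≤ M := by
    filter_upwards [hbd] with t ht
    rw [Complex.norm_exp]
    exact (Real.exp_le_exp.2 (le_abs_self _)).trans ht
  have hlow : ∀ᶠ t in 𝓝[>] t₀, M⁻¹ ≤ ‖Complex.exp (γ t)‖ := by
    filter_upwards [hbd] with t ht
    rw [Complex.norm_exp, inv_le_comm₀ hM (Real.exp_pos _), ← Real.exp_neg]
    exact (Real.exp_le_exp.2 (neg_le_abs _)).trans ht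
  -- Here r² is the discriminant of au² - wu + b, whose roots are the possible limits of u = exp(γ).
  obtain ⟨r, hr⟩ := IsAlgClosed.exists_pow_nat_eq (w ^ 2 - 4 * a * b) (n := 2) two_pos
  have hprod : Tendsto (fun t => (Complex.exp (γ t) - (w + r) / (2 * a)) *
      (Complex.exp (γ t) - (w - r) / (2 * a))) (𝓝[>] t₀) (𝓝 0) := by
    have h1 : Tendsto (fun t => (cosMap a b (γ t) - w) * a⁻¹ * Complex.exp (γ t)) (𝓝[>] t₀)
        (𝓝 0) := by
      have h2 := (h.sub_const w).mul_const a⁻¹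
      rw [sub_self, zero_mul] at h2
      exact h2.zero_mul_isBoundedUnder_le ⟨M, eventually_map.2 hup⟩
    refine h1.congr fun t => ?_
    have h0 : Complex.exp (γ t) * Complex.exp (-γ t) = 1 := by rw [← Complex.exp_add]; simp
    unfold cosMap
    field_simp
    linear_combination 4 * a * b * h0 + hr
  have hexp : ContinuousOn (fun t => Complex.exp (γ t)) (Ioi t₀) := hγ.cexp
  have key : ∀ u₀, Tendsto (fun t => Complex.exp (γ t)) (𝓝[>] t₀) (𝓝 u₀) →
      ∃ w', Tendsto γ (𝓝[>] t₀) (𝓝 w') := fun u₀ hu₀ => by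
    refine exists_tendsto_of_exp_tendsto hγ ?_ hu₀
    have := ge_of_tendsto hu₀.norm hlow
    exact norm_pos_iff.1 ((inv_pos.2 hM).trans_le this)
  rcases tendsto_or_of_mul_sub_tendsto_zero hexp hprod with h1 | h1
  · exact key _ h1
  · exact key _ h1

/-! ### Escape, growth and landing of rays. -/

/-- The whole curve `E^{∘n}(g)` beyond a potential lies in the `n`-th strip if `E^{∘(n+1)}` maps it
away from the slit. -/
lemma FollowsAddress.mem_strip (hg : FollowsAddress a b strip s g)
    (hst : IsStripLabelling a b c strip) {n : ℕ} {t : ℝ} (ht : minPotential s < t)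
    (h : ∀ u, t ≤ u → |(critVal₁ a b c).re| < |((cosMap a b)^[n + 1] (g u)).re|) :
    ∀ u, t ≤ u → (cosMap a b)^[n] (g u) ∈ strip (s n) := by
  have hK : IsPreconnected ((fun u => (cosMap a b)^[n] (g u)) '' Ici t) := by
    refine isPreconnected_Ici.image _ (((continuous_cosMap a b).iterate n).comp_continuousOn ?_)
    exact hg.continuousOn.mono (Ici_subset_Ioi.2 ht)
  obtain ⟨T, hT, hTs⟩ := hg.exists_mem_strip n t ht
  have hsub := hst.subset_of_isPreconnected hK (by
    rintro _ ⟨u, hu, rfl⟩ hslit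
    have h1 := h u hu
    rw [Function.iterate_succ_apply'] at h1
    exact absurd (abs_re_le_of_mem_slit hslit) (not_le.2 h1)) ⟨T, hT, rfl⟩ hTs
  exact fun u hu => hsub ⟨u, hu, rfl⟩

/-- Points that realize late shifts of a fast address have large real parts. -/
lemma IsFast.exists_lt_abs_re (hfast : IsFast s) (hst : IsStripLabelling a b c strip) (ha : a ≠ 0)
    (hc : Complex.exp (2 * c) = b / a) (ρ : ℝ) :
    ∃ N, ∀ n, N ≤ n → ∀ z, (∀ k, (cosMap a b)^[k + 1] z ∈ strip (s (n + (k + 1)))) →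
      ρ < |z.re| := by
  have hpi := Real.pi_gt_three
  set K := ‖a‖ + ‖b‖ with hK
  have hK0 : 0 ≤ K := by positivity
  set B := K + 1
  -- The margin B absorbs the constant of E: K·e^r + B ≤ e^{r+B} - 1 = F(r + B) for r ≥ 0.
  have hB : K + B + 1 ≤ Real.exp B := by
    have := Real.quadratic_le_exp_of_nonneg (x := B) (by positivity)
    have hB1 : B ^ 2 = K ^ 2 + 2 * K + 1 := by simp only [B]; ring
    nlinarith [sq_nonneg K]
  set C := 4 * Real.pi + 1
  have hC : 0 ≤ C := by positivity
  set x := K * Real.exp ρ + B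
  have hx : 1 ≤ x := by
    have : 0 ≤ K * Real.exp ρ := by positivity
    simp only [x, B]; linarith
  have hns : ∀ᶠ n in atTop, ¬ ∀ k, entryAbs (s (n + k)) ≤ (1 + C) * F^[k] x :=
    not_frequently.1 fun h => hfast ⟨1 + C, x, by positivity, by linarith, h⟩
  obtain ⟨N, hN⟩ := eventually_atTop.1 hns
  refine ⟨N, fun n hn z hz => ?_⟩
  by_contra! hzρ
  refine hN (n + 1) (by lia) fun k => ?_
  have hbound : ∀ k, ‖(cosMap a b)^[k + 1] z‖ + B ≤ F^[k] x := by
    intro k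
    induction k with
    | zero =>
      have h1 := norm_cosMap_le a b z
      have h2 : K * Real.exp |z.re| ≤ K * Real.exp ρ := by gcongr
      simp only [zero_add, Function.iterate_one, Function.iterate_zero, id]
      linarith
    | succ k ih =>
      rw [Function.iterate_succ_apply', Function.iterate_succ_apply' F]
      set w := (cosMap a b)^[k + 1] z
      have h1 := norm_cosMap_le a b w
      have h2 : K * Real.exp |w.re| ≤ K * Real.exp ‖w‖ := by
        gcongr; exact Complex.abs_re_le_norm w
      have h3 : Real.exp (‖w‖ + B) ≤ Real.exp (F^[k] x) := Real.exp_le_exp.2 ih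
      rw [Real.exp_add] at h3
      have h4 : Real.exp ‖w‖ * (K + B + 1) ≤ Real.exp ‖w‖ * Real.exp B := by gcongr
      have h5 : 1 ≤ Real.exp ‖w‖ := Real.one_le_exp (norm_nonneg w)
      have h6 : B + 1 ≤ Real.exp ‖w‖ * (B + 1) := le_mul_of_one_le_left (by positivity) h5
      rw [← hK] at h1
      change _ ≤ Real.exp (F^[k] x) - 1
      linarith
  have h1 := hst.abs_im_sub_le ha hc (hz k)
  set w := (cosMap a b)^[k + 1] z
  have h2 := Complex.abs_im_le_norm w
  have h3 := hbound k
  have h4 := le_F_iterate k x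
  have h5 : |2 * Real.pi * ((s (n + (k + 1))).1 : ℝ)| ≤ ‖w‖ + C := by
    have := abs_sub_abs_le_abs_sub (2 * Real.pi * ((s (n + (k + 1))).1 : ℝ)) w.im
    rw [abs_sub_comm] at this
    linarith
  rw [abs_mul, abs_of_pos (by positivity)] at h5
  have h6 : n + 1 + k = n + (k + 1) := by ring
  rw [h6]
  change |((s (n + (k + 1))).1 : ℝ)| ≤ _
  have h7 : |((s (n + (k + 1))).1 : ℝ)| ≤ 2 * Real.pi * |((s (n + (k + 1))).1 : ℝ)| :=
    le_mul_of_one_le_left (abs_nonneg _) (by linarith)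
  have h8 : C ≤ C * F^[k] x := le_mul_of_one_le_right hC (by linarith)
  have h9 : 0 ≤ B := by positivity
  linarith

/-- Fast rays escape uniformly. -/
lemma FollowsAddress.exists_lt_abs_re_of_isFast (hg : FollowsAddress a b strip s g)
    (hst : IsStripLabelling a b c strip) (ha : a ≠ 0) (hc : Complex.exp (2 * c) = b / a)
    (hfast : IsFast s) (ρ : ℝ) :
    ∃ N, ∀ n, N ≤ n → ∀ t, minPotential s < t → ρ < |((cosMap a b)^[n] (g t)).re| := by
  obtain ⟨N, hN⟩ := hfast.exists_lt_abs_re hst ha hc (max ρ |(critVal₁ a b c).re|)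
  refine ⟨N, fun n hn t ht => ?_⟩
  obtain ⟨n₀, hn₀⟩ := eventually_atTop.1 (hg.eventually_mem_strip t ht)
  have hfar : ∀ n, N ≤ n → (∀ m, n < m → ∀ u, t ≤ u → (cosMap a b)^[m] (g u) ∈ strip (s m)) →
      ∀ u, t ≤ u → max ρ |(critVal₁ a b c).re| < |((cosMap a b)^[n] (g u)).re| := by
    intro n hn hm u hu
    refine hN n hn _ fun k => ?_
    rw [← Function.iterate_add_apply, add_comm]
    exact hm _ (by lia) u hu
  -- Backward induction from n₀, which depends on t, down to N, which does not: strip membership at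
  -- all later times gives a large real part at time n + 1, hence membership at time n.
  have hmem : ∀ d n, N ≤ n → n₀ ≤ n + d → ∀ u, t ≤ u → (cosMap a b)^[n] (g u) ∈ strip (s n) := by
    intro d
    induction d with
    | zero => exact fun n _ h => hn₀ n h
    | succ d ih =>
      intro n hn hd
      refine hg.mem_strip hst ht fun u hu => (le_max_right ρ _).trans_lt ?_
      exact hfar (n + 1) (by lia) (fun m hm => ih m (by lia) (by lia)) u hu
  exact (le_max_left _ _).trans_lt
    (hfar n hn (fun m hm => hmem n₀ m (by lia) (by lia)) t le_rfl)

lemma FollowsAddress.mem_strip_of_lt (hg : FollowsAddress a b strip s g)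
    (hst : IsStripLabelling a b c strip) {N : ℕ}
    (h : ∀ n, N ≤ n → ∀ t, minPotential s < t →
      |(critVal₁ a b c).re| < |((cosMap a b)^[n] (g t)).re|)
    {n : ℕ} (hn : N ≤ n) {t : ℝ} (ht : minPotential s < t) :
    (cosMap a b)^[n] (g t) ∈ strip (s n) :=
  hg.mem_strip hst ht (fun u hu => h (n + 1) (by lia) u (ht.trans_le hu)) t le_rfl

/-- Rays that escape uniformly are fast. -/
lemma FollowsAddress.isFast_of_forall_lt (hg : FollowsAddress a b strip s g)
    (hst : IsStripLabelling a b c strip) (ha : a ≠ 0) (hb : b ≠ 0)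
    (hc : Complex.exp (2 * c) = b / a)
    (h : ∀ ρ : ℝ, ∃ N, ∀ n, N ≤ n → ∀ t, minPotential s < t →
      ρ < |((cosMap a b)^[n] (g t)).re|) : IsFast s := by
  rintro ⟨A, x, hA, hx, hfreq⟩
  have hpi := Real.pi_pos
  obtain ⟨k₀, hk₀, ρ₀, hρ₀⟩ := exists_le_norm_cosMap ha hb
  set C := 4 * Real.pi + 1
  have hC : 0 ≤ C := by positivity
  set D := 2 * Real.pi * A + C + 1
  have hD : 0 ≤ D := by positivity
  obtain ⟨B, hB0, hB⟩ : ∃ B, 0 ≤ B ∧ D + B ≤ k₀ * Real.exp B := by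
    set B := max 1 (2 / k₀ * (1 + D))
    have hB1 : 1 ≤ B := le_max_left _ _
    have hB2 : 2 / k₀ * (1 + D) ≤ B := le_max_right _ _
    refine ⟨B, by linarith, ?_⟩
    have h1 := Real.quadratic_le_exp_of_nonneg (x := B) (by linarith)
    have h2 : (1 + D) ≤ k₀ * B / 2 := by
      rw [div_mul_eq_mul_div, div_le_iff₀ hk₀] at hB2
      linarith
    have h3 : (1 + D) * B ≤ k₀ * B / 2 * B := by gcongr
    have h4 : D ≤ D * B := le_mul_of_one_le_right hD hB1
    have h5 : k₀ * (B ^ 2 / 2) ≤ k₀ * Real.exp B := by gcongr; linarith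
    linarith
  obtain ⟨N, hN⟩ := h (max (max ρ₀ |(critVal₁ a b c).re|) (x + 3 + B))
  obtain ⟨n, hs, hn⟩ := (hfreq.and_eventually (eventually_ge_atTop N)).exists
  -- The potential with value x + 1 at time n bounds the minimal potential, so the one with value x
  -- + 2 lies on the ray.
  obtain ⟨t₀, ht₀, ht₀'⟩ := exists_F_iterate_eq n (y := x + 1) (by linarith)
  obtain ⟨t, ht, ht'⟩ := exists_F_iterate_eq n (y := x + 2) (by linarith)
  have hlt : minPotential s < t := by
    refine (minPotential_le_of_le hx hs ht₀ (by linarith)).trans_lt ?_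
    exact (F_iterate_strictMono n).lt_iff_lt.1 (by linarith)
  have hmem : ∀ m, N ≤ m → (cosMap a b)^[m] (g t) ∈ strip (s m) := fun m hm =>
    hg.mem_strip_of_lt hst (fun n hn t ht =>
      ((le_max_right _ _).trans (le_max_left _ _)).trans_lt (hN n hn t ht)) hm hlt
  -- The modulus is at least k₀e^B times exp of the comparison iterate. As k₀e^B ≥ D + B, this pays
  -- for the height as well as for the next iterate plus B.
  have hgrow : ∀ k, F^[k] (x + 3) + B ≤ |((cosMap a b)^[n + k] (g t)).re| := by
    intro k
    induction k with
    | zero => exact (le_max_right _ _).trans (hN n hn t hlt).le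
    | succ k ih =>
      have h1 := hρ₀ _ (((le_max_left _ _).trans (le_max_left _ _)).trans
        (hN (n + k) (by lia) t hlt).le)
      rw [← Function.iterate_succ_apply' (cosMap a b)] at h1
      have h2 := hst.abs_im_sub_le ha hc (hmem (n + (k + 1)) (by lia))
      rw [Nat.succ_eq_add_one, add_assoc] at h1
      set w := (cosMap a b)^[n + (k + 1)] (g t)
      have h3 : |w.im| ≤ 2 * Real.pi * |((s (n + (k + 1))).1 : ℝ)| + C := by
        have := abs_sub_abs_le_abs_sub w.im (2 * Real.pi * ((s (n + (k + 1))).1 : ℝ))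
        rw [abs_mul (2 * Real.pi), abs_of_pos (by positivity : 0 < 2 * Real.pi)] at this
        linarith
      set e := Real.exp (F^[k] (x + 3))
      have hF : F^[k + 1] (x + 3) = e - 1 := by rw [Function.iterate_succ_apply', F]
      have he : 1 ≤ e := Real.one_le_exp (by linarith [le_F_iterate k (x + 3)])
      have h4 : |((s (n + (k + 1))).1 : ℝ)| ≤ A * e := by
        refine (hs (k + 1)).trans ?_
        have := (F_iterate_strictMono (k + 1)).monotone (show x ≤ x + 3 by linarith)
        gcongr
        linarith
      have h5 : 2 * Real.pi * |((s (n + (k + 1))).1 : ℝ)| ≤ 2 * Real.pi * (A * e) := by gcongr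
      have h6 : (D + B) * e ≤ k₀ * Real.exp |((cosMap a b)^[n + k] (g t)).re| := by
        calc (D + B) * e ≤ k₀ * Real.exp B * e := by gcongr
          _ = k₀ * Real.exp (F^[k] (x + 3) + B) := by rw [Real.exp_add]; ring
          _ ≤ _ := by gcongr
      have h7 := Complex.norm_le_abs_re_add_abs_im w
      have h8 : (D + B) * e = 2 * Real.pi * (A * e) + e + (C + B) * e := by simp only [D]; ring
      have h9 : C + B ≤ (C + B) * e := le_mul_of_one_le_right (by linarith) he
      rw [hF]
      linarith
  obtain ⟨C', hC'⟩ := hg.asymptotics t hlt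
  have hdiff : Tendsto (fun k => F^[k] (x + 3) - F^[k] (x + 2)) atTop atTop :=
    tendsto_F_iterate_sub (by linarith) (by linarith)
  have hC'' := (tendsto_add_atTop_nat n).eventually hC'
  obtain ⟨k, h1, h2⟩ := (hC''.and (hdiff.eventually_gt_atTop C')).exists
  rw [Function.iterate_add_apply F, ht'] at h1
  have h3 := hgrow k
  rw [add_comm n k] at h3
  have h4 := (abs_le.1 h1).2
  linarith

/-- Along a ray, real parts at lower potentials never exceed those at higher potentials by much. -/
lemma exists_abs_re_le_add (hst : IsStripLabelling a b c strip) (ha : a ≠ 0) (hb : b ≠ 0)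
    (hc : Complex.exp (2 * c) = b / a) :
    ∃ M ρ : ℝ, ∀ (s : Address) (g : ℝ → ℂ), FollowsAddress a b strip s g → ∀ N : ℕ,
      (∀ n, N ≤ n → ∀ t, minPotential s < t →
        (cosMap a b)^[n] (g t) ∈ strip (s n) ∧ ρ < |((cosMap a b)^[n] (g t)).re|) →
      ∀ n, N ≤ n → ∀ t t', minPotential s < t' → t' < t →
        |((cosMap a b)^[n] (g t')).re| ≤ |((cosMap a b)^[n] (g t)).re| + M := by
  obtain ⟨k₀, hk₀, ρ₀, hρ₀⟩ := exists_le_norm_cosMap ha hb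
  set C := 4 * Real.pi + 1
  set K := ‖a‖ + ‖b‖
  set M := 4 * K / k₀
  have hM : 4 * K ≤ k₀ * Real.exp M := by
    have h1 : M ≤ Real.exp M := by linarith [Real.add_one_le_exp M]
    calc 4 * K = k₀ * M := by simp only [M]; field_simp
      _ ≤ _ := by gcongr
  refine ⟨M, max ρ₀ (2 * C + M), fun s g hg N h n hn t t' ht' htt' => ?_⟩
  by_contra! hcon
  have ht := ht'.trans htt'
  -- An excess of M makes the next modulus four times larger. Heights in a common strip differ by at
  -- most 2C, so the excess must reappear in the real part, forever.
  have hall : ∀ k, |((cosMap a b)^[k + n] (g t)).re| + M < |((cosMap a b)^[k + n] (g t')).re| := by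
    intro k
    induction k with
    | zero => simpa using hcon
    | succ k ih =>
      have h1 := hρ₀ _ ((le_max_left _ _).trans (h (k + n) (by lia) t' ht').2.le)
      have h2 := norm_cosMap_le a b ((cosMap a b)^[k + n] (g t))
      rw [← Function.iterate_succ_apply' (cosMap a b), Nat.succ_eq_add_one,
        add_right_comm] at h1 h2
      have h3 := hst.abs_im_sub_le ha hc (h (k + 1 + n) (by lia) t ht).1
      have h4 := hst.abs_im_sub_le ha hc (h (k + 1 + n) (by lia) t' ht').1
      have h5 := (le_max_right _ _).trans_lt (h (k + 1 + n) (by lia) t ht).2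
      set z := (cosMap a b)^[k + n] (g t)
      set z' := (cosMap a b)^[k + n] (g t')
      set w := (cosMap a b)^[k + 1 + n] (g t)
      set w' := (cosMap a b)^[k + 1 + n] (g t')
      have h6 : 4 * ‖w‖ ≤ ‖w'‖ := by
        calc 4 * ‖w‖ ≤ 4 * (K * Real.exp |z.re|) := by gcongr
          _ = 4 * K * Real.exp |z.re| := by ring
          _ ≤ k₀ * Real.exp M * Real.exp |z.re| := by gcongr
          _ = k₀ * Real.exp (|z.re| + M) := by rw [Real.exp_add]; ring
          _ ≤ k₀ * Real.exp |z'.re| := by gcongr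
          _ ≤ ‖w'‖ := h1
      have h7 : |w'.im| ≤ |w.im| + 2 * C := by
        have h8 := abs_sub_abs_le_abs_sub w'.im w.im
        have h9 := abs_sub_le w'.im (2 * Real.pi * ((s (k + 1 + n)).1 : ℝ)) w.im
        rw [abs_sub_comm (2 * Real.pi * ((s (k + 1 + n)).1 : ℝ)) w.im] at h9
        linarith
      have h8 := Complex.norm_le_abs_re_add_abs_im w'
      have h9 := Complex.abs_im_le_norm w
      have h10 := Complex.abs_re_le_norm w
      have h11 := abs_nonneg w.re
      linarith
  obtain ⟨C₁, h₁⟩ := hg.asymptotics t ht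
  obtain ⟨C₂, h₂⟩ := hg.asymptotics t' ht'
  have h₃ := (tendsto_F_iterate_sub ((minPotential_nonneg s).trans_lt ht')
    htt').eventually_gt_atTop (C₁ + C₂ - M)
  obtain ⟨k, ⟨h1, h2⟩, h3⟩ := ((tendsto_add_atTop_nat n).eventually ((h₁.and h₂).and h₃)).exists
  have h4 := hall k
  have h5 := (abs_le.1 h1).1
  have h6 := (abs_le.1 h2).2
  linarith

/-- If late iterates of a ray stay far from the imaginary axis, they land. -/
lemma exists_tendsto_iterate (hst : IsStripLabelling a b c strip) (ha : a ≠ 0) (hb : b ≠ 0)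
    (hc : Complex.exp (2 * c) = b / a) :
    ∃ ρ : ℝ, ∀ (s : Address) (g : ℝ → ℂ), FollowsAddress a b strip s g → ∀ N : ℕ,
      (∀ n, N ≤ n → ∀ t, minPotential s < t → ρ < |((cosMap a b)^[n] (g t)).re|) →
      ∃ w, Tendsto (fun t => (cosMap a b)^[N] (g t)) (𝓝[>] minPotential s) (𝓝 w) := by
  obtain ⟨M, ρ₁, h₁⟩ := exists_abs_re_le_add hst ha hb hc
  obtain ⟨ρ₂, h₂⟩ := hst.exists_expansion ha hc
  refine ⟨max (max ρ₁ ρ₂) (max |c.re| |(critVal₁ a b c).re|), fun s g hg N h => ?_⟩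
  have hρ₁ := fun n hn t ht =>
    ((le_max_left ρ₁ ρ₂).trans (le_max_left _ _)).trans_lt (h n hn t ht)
  have hρ₂ := fun n hn t ht =>
    ((le_max_right ρ₁ ρ₂).trans (le_max_left _ _)).trans_lt (h n hn t ht)
  have hρc := fun n hn t ht =>
    ((le_max_left |c.re| |(critVal₁ a b c).re|).trans (le_max_right _ _)).trans_lt (h n hn t ht)
  have hρv := fun n hn t ht =>
    ((le_max_right |c.re| |(critVal₁ a b c).re|).trans (le_max_right _ _)).trans_lt (h n hn t ht)
  have hmem : ∀ n, N ≤ n → ∀ t, minPotential s < t → (cosMap a b)^[n] (g t) ∈ strip (s n) :=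
    fun n hn t ht => hg.mem_strip_of_lt hst hρv hn ht
  have hmono := h₁ s g hg N fun n hn t ht => ⟨hmem n hn t ht, hρ₁ n hn t ht⟩
  have hexpand : ∀ t t', minPotential s < t → minPotential s < t' → ∀ m,
      2 ^ m * ‖(cosMap a b)^[N] (g t) - (cosMap a b)^[N] (g t')‖ ≤
        ‖(cosMap a b)^[N + m] (g t) - (cosMap a b)^[N + m] (g t')‖ := by
    intro t t' ht ht' m
    induction m with
    | zero => simp
    | succ m ih =>
      have e := fun t => Function.iterate_succ_apply' (cosMap a b) (N + m) (g t)
      have := h₂ _ (s (N + m + 1)) _ (hmem (N + m) (by lia) t ht) _ (hmem (N + m) (by lia) t' ht')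
        (e t ▸ hmem _ (by lia) t ht) (e t' ▸ hmem _ (by lia) t' ht') (hρ₂ _ (by lia) t ht).le
        (hρ₂ _ (by lia) t' ht').le (e t ▸ hρ₂ _ (by lia) t ht).le (e t' ▸ hρ₂ _ (by lia) t' ht').le
      rw [← e, ← e] at this
      refine le_trans ?_ this
      rw [pow_succ']
      linarith
  set C := 4 * Real.pi + 1
  set D := M + 1 + 2 * C
  have hosc : ∀ n, N ≤ n → ∃ T, minPotential s < T ∧ ∀ t ∈ Ioo (minPotential s) T,
      ∀ t' ∈ Ioo (minPotential s) T,
        ‖(cosMap a b)^[n] (g t) - (cosMap a b)^[n] (g t')‖ ≤ D := by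
    intro n hn
    -- Taking T within 1 of the infimum traps all lower potentials between the infimum and the
    -- infimum plus M + 1, uniformly in n.
    set R := (fun t => |((cosMap a b)^[n] (g t)).re|) '' Ioi (minPotential s)
    have hbdd : BddBelow R := ⟨0, by rintro _ ⟨t, -, rfl⟩; exact abs_nonneg _⟩
    obtain ⟨_, ⟨T, hT, rfl⟩, hlt⟩ := exists_lt_of_csInf_lt
      (nonempty_Ioi.image fun t => |((cosMap a b)^[n] (g t)).re|) (lt_add_one (sInf R))
    refine ⟨T, hT, fun t ht t' ht' => ?_⟩
    have e1 := csInf_le hbdd ⟨t, ht.1, rfl⟩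
    have e2 := csInf_le hbdd ⟨t', ht'.1, rfl⟩
    have e3 := hmono n hn T t ht.1 ht.2
    have e4 := hmono n hn T t' ht'.1 ht'.2
    have h3 := abs_le.1 (hst.abs_im_sub_le ha hc (hmem n hn t ht.1))
    have h4 := abs_le.1 (hst.abs_im_sub_le ha hc (hmem n hn t' ht'.1))
    have h5 := hρc n hn t ht.1
    have h6 := hρc n hn t' ht'.1
    have hside := hst.re_lt_or ha hc (s n)
    have hz := hmem n hn t ht.1
    have hz' := hmem n hn t' ht'.1
    beta_reduce at e1 e2 hlt
    set z := (cosMap a b)^[n] (g t)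
    set z' := (cosMap a b)^[n] (g t')
    have hc1 := le_abs_self c.re
    have hc2 := neg_abs_le c.re
    have hre : |(z - z').re| ≤ M + 1 := by
      rw [Complex.sub_re]
      rcases hside with hr | hr
      · have hp : 0 < z.re := by
          have := hr z hz
          rcases abs_cases z.re with ⟨h7, h8⟩ | ⟨h7, h8⟩ <;> linarith
        have hp' : 0 < z'.re := by
          have := hr z' hz'
          rcases abs_cases z'.re with ⟨h7, h8⟩ | ⟨h7, h8⟩ <;> linarith
        rw [abs_of_pos hp] at e1 e3
        rw [abs_of_pos hp'] at e2 e4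
        rw [abs_le]; constructor <;> linarith
      · have hp : z.re < 0 := by
          have := hr z hz
          rcases abs_cases z.re with ⟨h7, h8⟩ | ⟨h7, h8⟩ <;> linarith
        have hp' : z'.re < 0 := by
          have := hr z' hz'
          rcases abs_cases z'.re with ⟨h7, h8⟩ | ⟨h7, h8⟩ <;> linarith
        rw [abs_of_neg hp] at e1 e3
        rw [abs_of_neg hp'] at e2 e4
        rw [abs_le]; constructor <;> linarith
    have him : |(z - z').im| ≤ 2 * C := by
      rw [Complex.sub_im, abs_le]; constructor <;> linarith
    exact (Complex.norm_le_abs_re_add_abs_im _).trans (add_le_add hre him)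
  refine cauchy_map_iff_exists_tendsto.1 (Metric.cauchy_iff.2 ⟨inferInstance, fun ε hε => ?_⟩)
  obtain ⟨m, hm⟩ := pow_unbounded_of_one_lt (D / ε) (one_lt_two : (1 : ℝ) < 2)
  obtain ⟨T, hT, hosc⟩ := hosc (N + m) (by lia)
  refine ⟨_, image_mem_map (Ioo_mem_nhdsGT hT), ?_⟩
  rintro _ ⟨t, ht, rfl⟩ _ ⟨t', ht', rfl⟩
  rw [dist_eq_norm]
  have h3 := (hexpand t t' ht.1 ht'.1 m).trans (hosc t ht t' ht')
  rw [div_lt_iff₀ hε] at hm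
  exact lt_of_mul_lt_mul_left (h3.trans_lt hm) (by positivity)

lemma exists_tendsto_of_iterate_tendsto (ha : a ≠ 0) (hb : b ≠ 0) {t₀ : ℝ}
    (hg : ContinuousOn g (Ioi t₀)) (N : ℕ)
    (h : ∃ w, Tendsto (fun t => (cosMap a b)^[N] (g t)) (𝓝[>] t₀) (𝓝 w)) :
    ∃ w, Tendsto g (𝓝[>] t₀) (𝓝 w) := by
  induction N with
  | zero => exact h
  | succ N ih =>
    obtain ⟨w, hw⟩ := h
    simp only [Function.iterate_succ_apply'] at hw
    exact ih (exists_tendsto_of_cosMap_tendsto ha hb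
      (((continuous_cosMap a b).iterate N).comp_continuousOn hg) hw)

end CosineRays

theorem proposition6p5 (a b c : ℂ) (ha : a ≠ 0) (hb : b ≠ 0)
    (hc : Complex.exp (2 * c) = b / a) (hcIm : |c.im| ≤ Real.pi / 2)
    (strip : ℤ × CosineRays.Side → Set ℂ) (hstrip : CosineRays.IsStripLabelling a b c strip)
    (s : CosineRays.Address) (hs : CosineRays.ExponentiallyBounded s)
    (g : ℝ → ℂ) (hg : CosineRays.IsDynamicRay a b c strip s g) :
    CosineRays.IsFast s ↔
      ∃ w : ℂ, CosineRays.LandsAt s g w ∧ CosineRays.IsEscaping a b w ∧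
        CosineRays.EscapeUniformly a b s g w := by
  have hgs := hg.followsAddress hs
  constructor
  · intro hfast
    have hU := hgs.exists_lt_abs_re_of_isFast hstrip ha hc hfast
    obtain ⟨ρ, hρ⟩ := CosineRays.exists_tendsto_iterate hstrip ha hb hc
    obtain ⟨N, hN⟩ := hU ρ
    obtain ⟨w, hw⟩ := CosineRays.exists_tendsto_of_iterate_tendsto ha hb hgs.continuousOn N
      (hρ s g hgs N hN)
    have hlim : ∀ n, Tendsto (fun t => |((CosineRays.cosMap a b)^[n] (g t)).re|)
        (𝓝[>] (CosineRays.minPotential s)) (𝓝 |((CosineRays.cosMap a b)^[n] w).re|) := fun n =>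
      ((Complex.continuous_re.comp
        ((CosineRays.continuous_cosMap a b).iterate n)).abs.tendsto w).comp hw
    have hunif : CosineRays.EscapeUniformly a b s g w := by
      intro r
      -- The limit keeps only a weak inequality; the extra 1 restores the strict one at w.
      obtain ⟨N, hN⟩ := hU (r + 1)
      refine ⟨N, fun n hn => ⟨?_, fun t ht => (lt_add_one r).trans (hN n hn t ht)⟩⟩
      refine (lt_add_one r).trans_le (ge_of_tendsto (hlim n) ?_)
      filter_upwards [self_mem_nhdsWithin] with t ht using (hN n hn t ht).le
    refine ⟨w, hw, ?_, hunif⟩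
    refine tendsto_atTop.2 fun r => ?_
    obtain ⟨N, hN⟩ := hunif r
    filter_upwards [eventually_ge_atTop N] with n hn
    exact (hN n hn).1.le.trans (Complex.abs_re_le_norm _)
  · rintro ⟨w, -, -, hunif⟩
    refine hgs.isFast_of_forall_lt hstrip ha hb hc fun ρ => ?_
    obtain ⟨N, hN⟩ := hunif ρ
    exact ⟨N, fun n hn => (hN n hn).2⟩
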